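/- Let $p\in\mathbb Z$ and $q\in\mathbb Z_{>0}$ be coprime, and let $\theta=\begin{pmatrix}0&p/q\\-p/q&0\end{pmatrix}$. Let $C_\theta=C(\mathbb S^3_\theta)$ be the universal unital $C^*$-algebra generated by normal elements $T_1,T_2$ subject to $T_jT_i=e^{2\pi i\theta_{ij}}T_iT_j$ for all $i,j$ and $T_1^*T_1+T_2^*T_2=1$. Let $Z$ be the center of $C_\theta$ and $X=\operatorname{Max}Z$ its maximal spectrum (a topological 3-sphere). Let $\mathcal S\to X$ be the associated $C^*$-bundle: its fiber at $x\in X$ is the quotient of $C_\theta$ by the closed ideal generated by the maximal ideal of $Z$ corresponding to $x$, and its total space is topologized by requiring the sets $\{(y,b): y\in U,\ \|b-c_y\|<\varepsilon\}$ ($c\in C_\theta$ with image $c_y$ in $\mathcal S_y$, $U\subseteq X$ open, $\varepsilon>0$) to generate the topology. The elements $T_i^*T_i$ are central, and $X$ is the union of the two solid tori $X_1=\{T_2^*T_2\le T_1^*T_1\}$ and $X_2=\{T_1^*T_1\le T_2^*T_2\}$ of its Heegaard decomposition, where central elements are regarded as functions on $X$. Let $i\in\{1,2\}$ and let $n$ be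 a non-negative integer. If the restriction $\mathcal S|_{X_i}$ embeds into a locally trivial $M_n(\mathbb C)$-bundle $\mathcal B\to X_i$, i.e. if there is a continuous map $\mathcal S|_{X_i}\to\mathcal B$ over $X_i$ which is an injective unital $*$-homomorphism on each fiber, then $q^2$ divides $n$. -/

import Mathlib

open scoped ENNReal Topology

universe v

noncomputable section

/-! ### Bundles of unital `*`-algebras -/

/-- The total space of a family of fibers `E x`, `x : X` (with no topology a priori). -/
structure FiberTotal {X : Type*} (E : X → Type*) where
  base : X
  val : E base

/-- A bundle of unital complex `*`-algebras over `X`: a family of `*`-algebras, together with a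
topology on its total space for which the projection to `X` is continuous.  The `C*`-norm of a
fiber, if there is one, is determined by its `*`-algebra structure. -/
structure StarAlgebraBundle.{u, w} (X : Type u) [TopologicalSpace X] where
  Fiber : X → Type w
  [ring : ∀ x, Ring (Fiber x)]
  [algebra : ∀ x, Algebra ℂ (Fiber x)]
  [starRing : ∀ x, StarRing (Fiber x)]
  [starModule : ∀ x, StarModule ℂ (Fiber x)]
  [topology : TopologicalSpace (FiberTotal Fiber)]
  continuous_base : Continuous (FiberTotal.base : FiberTotal Fiber → X)

namespace StarAlgebraBundle

attribute [instance] ring algebra starRing starModule topology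

variable {X : Type*} [TopologicalSpace X]

/-- The restriction of a bundle to a subset of the base, with the subspace topology on
the total space. -/
def restrict (B : StarAlgebraBundle X) (T : Set X) : StarAlgebraBundle T where
  Fiber x := B.Fiber x
  topology := TopologicalSpace.induced
    (fun s => (⟨(s.base : X), s.val⟩ : FiberTotal B.Fiber)) B.topology
  continuous_base := by
    let _ : TopologicalSpace (FiberTotal (fun x : T => B.Fiber x)) :=
      TopologicalSpace.induced
        (fun s => (⟨(s.base : X), s.val⟩ : FiberTotal B.Fiber)) B.topology
    refine continuous_induced_rng.2 ?_
    exact B.continuous_base.comp (continuous_induced_dom (f := fun s : FiberTotal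
      (fun x : T => B.Fiber x) => (⟨(s.base : X), s.val⟩ : FiberTotal B.Fiber)))

/-- An embedding of bundles over `X`: a continuous map of total spaces which covers the identity
of `X` and is a unital injective `*`-homomorphism on each fiber. -/
structure Embedding (B B' : StarAlgebraBundle X) where
  toFun : ∀ x, B.Fiber x →⋆ₐ[ℂ] B'.Fiber x
  injective : ∀ x, Function.Injective (toFun x)
  continuous : Continuous
    (fun s : FiberTotal B.Fiber => (⟨s.base, toFun s.base s.val⟩ : FiberTotal B'.Fiber))

/-- `B` is a locally trivial bundle with fiber the `n × n` matrix algebra `M_n(ℂ)`: each point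
of the base has an open neighbourhood `U` over which `B` is identified with `U × M_n(ℂ)` by a
homeomorphism that is a `*`-isomorphism on each fiber. -/
def IsLocallyTrivialMatrixBundle (n : ℕ) (B : StarAlgebraBundle X) : Prop :=
  ∀ x : X, ∃ U : Set X, IsOpen U ∧ x ∈ U ∧
    ∃ φ : ∀ y : U, B.Fiber y ≃⋆ₐ[ℂ] Matrix (Fin n) (Fin n) ℂ,
      IsHomeomorph (fun s : {s : FiberTotal B.Fiber // s.base ∈ U} =>
        ((⟨s.1.base, s.2⟩, φ ⟨s.1.base, s.2⟩ s.1.val) : U × Matrix (Fin n) (Fin n) ℂ))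

end StarAlgebraBundle

/-! ### The bundle of a `C*`-algebra over the maximal spectrum of its center -/

section Center

variable (A : Type*) [CStarAlgebra A]

/-- The center of a unital `C*`-algebra. -/
def cstarCenter : StarSubalgebra ℂ A where
  toSubalgebra := Subalgebra.center ℂ A
  star_mem' := fun ha => Set.star_mem_center ha

/-- The maximal spectrum of the center, realised as its space of characters (with the weak-`*`
topology): a character corresponds to its kernel. -/
abbrev MaxCenter := WeakDual.characterSpace ℂ (cstarCenter A)

end Center

section CenterBundle

variable {A : Type*} [CStarAlgebra A]

/-- The closed ideal of `A` generated by the maximal ideal `ker x` of the center. -/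
def fiberIdeal (x : MaxCenter A) : Ideal A :=
  (Ideal.span {a : A | ∃ z : cstarCenter A, x z = 0 ∧ (z : A) = a}).closure

lemma cstarCenter_mul_comm (z : cstarCenter A) (a : A) : (z : A) * a = a * z :=
  ((Subalgebra.mem_center_iff (R := ℂ)).1 z.2 a).symm

lemma map_star_eq_zero_of_character (x : MaxCenter A) (z : cstarCenter A) (hz : x z = 0) :
    x (star z) = 0 := by
  have : IsClosed ((cstarCenter A : StarSubalgebra ℂ A) : Set A) := by
    have h : ((cstarCenter A : StarSubalgebra ℂ A) : Set A) = Set.centralizer Set.univ :=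
      (Set.centralizer_univ (M := A)).symm
    rw [h]
    exact Set.isClosed_centralizer _
  rw [map_star, hz, star_zero]

instance (x : MaxCenter A) : (fiberIdeal x).IsTwoSided where
  mul_mem_of_left {a} b ha := by
    refine map_mem_closure (f := fun c => c * b) (continuous_mul_const b) ha ?_
    intro c hc
    refine Submodule.span_induction (p := fun c _ => c * b ∈ Ideal.span _) ?_ ?_ ?_ ?_ hc
    · rintro _ ⟨z, hz, rfl⟩
      rw [cstarCenter_mul_comm]
      exact Ideal.mul_mem_left _ _ (Ideal.subset_span ⟨z, hz, rfl⟩)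
    · simp
    · intro u v _ _ hu hv
      rw [add_mul]
      exact add_mem hu hv
    · intro r u _ hu
      rw [smul_eq_mul, mul_assoc]
      exact Ideal.mul_mem_left _ _ hu

lemma star_mem_fiberIdeal (x : MaxCenter A) {a : A} (ha : a ∈ fiberIdeal x) :
    star a ∈ fiberIdeal x := by
  refine map_mem_closure continuous_star ha ?_
  intro c hc
  refine Submodule.span_induction (p := fun c _ => star c ∈ Ideal.span _) ?_ ?_ ?_ ?_ hc
  · rintro _ ⟨z, hz, rfl⟩
    exact Ideal.subset_span ⟨star z, map_star_eq_zero_of_character x z hz, rfl⟩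
  · simp
  · intro u v _ _ hu hv
    rw [star_add]
    exact add_mem hu hv
  · intro r u hu' hu
    rw [smul_eq_mul, star_mul]
    -- right multiplication preserves the ideal, as it is generated by central elements
    refine Submodule.span_induction (p := fun c _ => c * star r ∈ Ideal.span _) ?_ ?_ ?_ ?_ hu
    · rintro _ ⟨z, hz, rfl⟩
      rw [cstarCenter_mul_comm]
      exact Ideal.mul_mem_left _ _ (Ideal.subset_span ⟨z, hz, rfl⟩)
    · simp
    · intro u v _ _ hu hv
      rw [add_mul]
      exact add_mem hu hv
    · intro s u _ hu
      rw [smul_eq_mul, mul_assoc]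
      exact Ideal.mul_mem_left _ _ hu

/-- The fiber at `x` of the bundle attached to `A`: the quotient of `A` by the closed ideal
generated by `ker x`.  Its `C*`-norm is the quotient norm. -/
abbrev CenterFiber (x : MaxCenter A) := A ⧸ fiberIdeal x

instance (x : MaxCenter A) : StarRing (CenterFiber x) where
  star := Quotient.map' star fun a b h => by
    have h' : a - b ∈ fiberIdeal x := (Submodule.quotientRel_def _).1 h
    refine (Submodule.quotientRel_def _).2 ?_
    rw [← star_sub]
    exact star_mem_fiberIdeal x h'
  star_involutive := by
    rintro ⟨a⟩
    exact congrArg (Ideal.Quotient.mk (fiberIdeal x)) (star_star a)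
  star_mul := by
    rintro ⟨a⟩ ⟨b⟩
    exact congrArg (Ideal.Quotient.mk (fiberIdeal x)) (star_mul a b)
  star_add := by
    rintro ⟨a⟩ ⟨b⟩
    exact congrArg (Ideal.Quotient.mk (fiberIdeal x)) (star_add a b)

instance (x : MaxCenter A) : StarModule ℂ (CenterFiber x) where
  star_smul := by
    rintro r ⟨a⟩
    exact congrArg (Ideal.Quotient.mk (fiberIdeal x)) (star_smul r a)

/-- The basic open set of points `(y, b)` of the total space with `y ∈ U` and `b` at distance less
than `ε` from the value at `y` of the section given by `a`. -/
def centerTube (a : A) (U : Set (MaxCenter A)) (ε : ℝ) :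
    Set (FiberTotal (fun x : MaxCenter A => CenterFiber x)) :=
  {s | s.base ∈ U ∧ ‖s.val - Ideal.Quotient.mk (fiberIdeal s.base) a‖ < ε}

variable (A) in
/-- The `C*`-bundle over the maximal spectrum of the center of `A` whose algebra of continuous
sections is `A`.  The topology of the total space is generated by the tubes around the
sections given by the elements of `A`. -/
def centerBundle : StarAlgebraBundle (MaxCenter A) where
  Fiber x := CenterFiber x
  topology := TopologicalSpace.generateFrom
    {W | ∃ (a : A) (U : Set (MaxCenter A)) (ε : ℝ), IsOpen U ∧ 0 < ε ∧ W = centerTube a U ε}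
  continuous_base := by
    let _ : TopologicalSpace (FiberTotal (fun x : MaxCenter A => CenterFiber x)) :=
      TopologicalSpace.generateFrom
        {W | ∃ (a : A) (U : Set (MaxCenter A)) (ε : ℝ), IsOpen U ∧ 0 < ε ∧ W = centerTube a U ε}
    refine continuous_def.2 fun U hU => ?_
    have h : (FiberTotal.base ⁻¹' U : Set (FiberTotal (fun x : MaxCenter A => CenterFiber x))) =
        ⋃ k : ℕ, centerTube (0 : A) U (k + 1) := by
      ext s
      simp only [Set.mem_preimage, Set.mem_iUnion, centerTube, Set.mem_ofPred_eq]
      refine ⟨fun hs => ?_, fun ⟨_, hs, _⟩ => hs⟩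
      obtain ⟨k, hk⟩ := exists_nat_gt ‖s.val - Ideal.Quotient.mk (fiberIdeal s.base) 0‖
      exact ⟨k, hs, hk.trans (lt_add_one _)⟩
    rw [h]
    exact isOpen_iUnion fun k =>
      TopologicalSpace.isOpen_generateFrom_of_mem ⟨0, U, k + 1, hU, by positivity, rfl⟩

end CenterBundle

/-! ### Quantum spheres -/

/-- The defining relations of the function algebra of the quantum sphere with parameter `θ`. -/
structure IsSphereFamily {m : ℕ} (θ : Matrix (Fin m) (Fin m) ℝ) {A : Type*} [CStarAlgebra A]
    (T : Fin m → A) : Prop where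
  normal : ∀ i, IsStarNormal (T i)
  comm : ∀ i j, T j * T i = Complex.exp (2 * Real.pi * Complex.I * θ i j) • (T i * T j)
  sum_eq_one : ∑ i, star (T i) * T i = 1

lemma IsSphereFamily.norm_le_one {m : ℕ} {θ : Matrix (Fin m) (Fin m) ℝ} {A : Type*}
    [CStarAlgebra A] {T : Fin m → A} (h : IsSphereFamily θ T) (i : Fin m) : ‖T i‖ ≤ 1 := by
  let _ := CStarAlgebra.spectralOrder A
  let _ := CStarAlgebra.spectralOrderedRing A
  have h1 : star (T i) * T i ≤ 1 := by
    rw [← h.sum_eq_one]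
    exact Finset.single_le_sum (f := fun i => star (T i) * T i)
      (fun j _ => star_mul_self_nonneg (T j)) (Finset.mem_univ i)
  have h2 : ‖star (T i) * T i‖ ≤ 1 :=
    (CStarAlgebra.norm_le_one_iff_of_nonneg _ (star_mul_self_nonneg (T i))).2 h1
  rw [CStarRing.norm_star_mul_self] at h2
  nlinarith [norm_nonneg (T i)]

/-- A family in some nonzero unital `C*`-algebra that satisfies the relations of the quantum
sphere.  Since a finitely generated `C*`-algebra has at most the cardinality of the continuum,
every such family in a `C*`-algebra of any universe occurs here, up to isomorphism of the
generated subalgebra. -/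
structure SphereRealization {m : ℕ} (θ : Matrix (Fin m) (Fin m) ℝ) where
  Alg : Type
  [cstar : CStarAlgebra Alg]
  [nontrivial : Nontrivial Alg]
  T : Fin m → Alg
  isSphereFamily : IsSphereFamily θ T

attribute [instance] SphereRealization.cstar SphereRealization.nontrivial

section Sphere

variable {m : ℕ} (θ : Matrix (Fin m) (Fin m) ℝ)

/-- The `ℓ^∞`-product of all realizations. -/
abbrev SphereProduct := lp (fun r : SphereRealization θ => r.Alg) ∞

instance : CStarAlgebra (SphereProduct θ) where

/-- The tautological family in the product of all realizations. -/
def sphereProductGen (i : Fin m) : SphereProduct θ :=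
  ⟨fun r => r.T i, memℓp_infty ⟨1, by
    rintro _ ⟨r, rfl⟩
    exact r.isSphereFamily.norm_le_one i⟩⟩

/-- The `C*`-subalgebra generated by the tautological family in the product of all
realizations. -/
def sphereSubalgebra : StarSubalgebra ℂ (SphereProduct θ) :=
  (StarAlgebra.adjoin ℂ (Set.range (sphereProductGen θ))).topologicalClosure

/-- The function algebra `C(𝕊_θ)` of the quantum sphere with parameter `θ`: the universal unital
`C*`-algebra generated by normal elements `T_i` with `T_j T_i = e^{2π i θ_{ij}} T_i T_j` and
`∑ T_i^* T_i = 1`. -/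
def SphereAlgebra : Type 1 := sphereSubalgebra θ

instance : CStarAlgebra (SphereAlgebra θ) :=
  haveI : IsClosed ((sphereSubalgebra θ : StarSubalgebra ℂ (SphereProduct θ)) :
      Set (SphereProduct θ)) := isClosed_closure
  inferInstanceAs (CStarAlgebra (sphereSubalgebra θ))

/-- The canonical generators of the function algebra of the quantum sphere. -/
def sphereGen (i : Fin m) : SphereAlgebra θ :=
  (⟨sphereProductGen θ i, subset_closure
    (StarAlgebra.subset_adjoin ℂ (Set.range (sphereProductGen θ)) ⟨i, rfl⟩)⟩ : sphereSubalgebra θ)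

lemma isSphereFamily_sphereProductGen : IsSphereFamily θ (sphereProductGen θ) where
  normal i := ⟨by
    refine lp.ext (funext fun r => ?_)
    exact (r.isSphereFamily.normal i).star_comm_self⟩
  comm i j := by
    refine lp.ext (funext fun r => ?_)
    exact r.isSphereFamily.comm i j
  sum_eq_one := by
    refine lp.ext (funext fun r => ?_)
    rw [lp.coeFn_sum, Finset.sum_apply]
    exact r.isSphereFamily.sum_eq_one

lemma IsSphereFamily.commute_star_mul_self {θ : Matrix (Fin m) (Fin m) ℝ} {A : Type*}
    [CStarAlgebra A] {T : Fin m → A} (h : IsSphereFamily θ T) (i j : Fin m) :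
    Commute (star (T i) * T i) (T j) := by
  set c := Complex.exp (2 * Real.pi * Complex.I * θ i j) with hc
  have hcc : c * star c = 1 := by
    have h1 : ‖c‖ = 1 := by
      have : (2 * Real.pi * Complex.I * θ i j : ℂ) = ((2 * Real.pi * θ i j : ℝ) : ℂ) *
        Complex.I := by push_cast; ring
      rw [hc, this, Complex.norm_exp_ofReal_mul_I]
    have h2 := Complex.mul_conj c
    rw [Complex.normSq_eq_norm_sq, h1] at h2
    simpa using h2
  have h1 : SemiconjBy (T j) (T i) (c • T i) := by
    rw [SemiconjBy, smul_mul_assoc]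
    exact h.comm i j
  have hn : IsStarNormal (c • T i) := ⟨by
    have := (h.normal i).star_comm_self
    rw [star_smul]
    exact (this.smul_left _).smul_right _⟩
  have h2 := SemiconjBy.star_right (h.normal i) hn h1
  have h3 : T j * (star (T i) * T i) = (star (c • T i) * (c • T i)) * T j := h2.mul_right h1
  rw [star_smul, smul_mul_smul_comm, mul_comm (star c), hcc, one_smul] at h3
  exact h3.symm

lemma star_mul_self_sphereGen_mem_center (i : Fin m) :
    star (sphereGen θ i) * sphereGen θ i ∈ cstarCenter (SphereAlgebra θ) := by
  refine (Subalgebra.mem_center_iff (R := ℂ)).2 fun a => ?_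
  have hF := isSphereFamily_sphereProductGen θ
  have hmem : star (sphereProductGen θ i) * sphereProductGen θ i ∈
      StarSubalgebra.centralizer ℂ (Set.range (sphereProductGen θ)) := by
    rw [StarSubalgebra.mem_centralizer_iff]
    rintro _ ⟨j, rfl⟩
    have h := hF.commute_star_mul_self i j
    refine ⟨h.symm.eq, ?_⟩
    have h' := congrArg star h.eq
    simpa only [star_mul, star_star] using h'
  have ha : (show sphereSubalgebra θ from a).1 ∈ StarSubalgebra.centralizer ℂ
      (StarSubalgebra.centralizer ℂ (Set.range (sphereProductGen θ)) :
        Set (SphereProduct θ)) :=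
    StarSubalgebra.topologicalClosure_adjoin_le_centralizer_centralizer ℂ _
      (show sphereSubalgebra θ from a).2
  rw [StarSubalgebra.mem_centralizer_iff] at ha
  exact Subtype.ext (ha _ hmem).1.symm

/-- The central element `T_i^* T_i`; as a function on the maximal spectrum of the center it is
`t_i ^ 2`, where `T_i = t_i U_i` with `t_i ≥ 0`. -/
def sphereRadius (i : Fin m) : cstarCenter (SphereAlgebra θ) :=
  ⟨star (sphereGen θ i) * sphereGen θ i, star_mul_self_sphereGen_mem_center θ i⟩

/-- The bundle attached to the quantum sphere, over the maximal spectrum of the center of its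
function algebra. -/
def sphereBundle : StarAlgebraBundle (MaxCenter (SphereAlgebra θ)) :=
  centerBundle (SphereAlgebra θ)

end Sphere

/-- The two solid tori of the Heegaard decomposition of the 3-sphere that is the maximal spectrum
of the center of the function algebra of a quantum 3-sphere: the loci
`t_j ^ 2 ≤ t_i ^ 2` (for `j ≠ i`), where `t_0 ^ 2 + t_1 ^ 2 = 1`.  The core circle of the solid
torus with index `i` is the locus `t_i = 1`. -/
def heegaardSolidTorus (θ : Matrix (Fin 2) (Fin 2) ℝ) (i : Fin 2) :
    Set (MaxCenter (SphereAlgebra θ)) :=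
  {x | ∀ j, (x (sphereRadius θ j)).re ≤ (x (sphereRadius θ i)).re}

end

/-!
The bundle of the quantum sphere is studied near the core circle of the solid torus. Put
`ω = e^{2πi θ_ij}`, a primitive `q`-th root of unity, where `i` is the index of the solid torus and
`j` is the other index. Clock and shift matrices represent `T_i` as `a` times the clock matrix and
`T_j` as `b` times the shift matrix; their central characters give a continuous family of points of
the solid torus, which depends only on `a ^ q` and `b ^ q` (`centralPoint_shift`,
`centralPoint_rotate`). With `a = |a| e^{is}`, the core circle is `b = 0`. In the fiber over such a
point, `T_i ^ q = a ^ q` and `T_j ^ q = b ^ q`.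

In a local trivialization of the matrix bundle, the images of `T_i` and `T_j`, divided by `a` and by
a positive factor, become matrices `X` and `V` with `V X = ω X V`, `X ^ q = 1` and `V ^ q = b ^ q`
(`RotationChart`, `sphereChart`). The eigenprojections of `X` extend continuously over the core
circle, and off the core circle `V` maps each eigenspace isomorphically onto the next one. On small
discs transversal to the core circle the eigenspaces can be identified with one another, so that the
determinant of `V` between two consecutive eigenspaces has a winding number `d` along the boundary
of such a disc. The number `d` depends neither on the identification nor on the local trivialization
(`RotationChart.Compatible.winding_unique`), and it is locally constant in the position `s` of the
disc (`RotationChart.exists_eventually_hasWinding`). As `s` moves once around the core circle in the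
coordinate `a ^ q`, the eigenspaces are permuted cyclically; hence `d` is the same for all `q`
eigenspaces. The sum of these winding numbers is that of `det V`, which is `n` because
`V ^ q = b ^ q`; hence `q d = n`. Finally, `X` and `V` depend on `b` only through the point of the
solid torus, that is, through `b ^ q`, and so `q` divides `d`. Thus `q ^ 2` divides `n`
(`sq_dvd_of_rotationChart_cover`).
-/

noncomputable section

/-! ### Winding numbers of loops in the punctured plane -/

/-- The `2π`-periodic function `f : ℝ → ℂ`, regarded as a loop in the punctured plane, has winding
number `d`: it has a continuous logarithm `h` which grows by `2πi d` over each period. -/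
def HasWinding (f : ℝ → ℂ) (d : ℤ) : Prop :=
  ∃ h : ℝ → ℂ, Continuous h ∧ (∀ t, f t = Complex.exp (h t)) ∧
    ∀ t, h (t + 2 * Real.pi) = h t + d * (2 * Real.pi * Complex.I)

/-- A continuous function on a connected space whose values are multiples of `2πi` is constant. -/
lemma exists_eq_int_mul_of_exp_eq_one {A : Type*} [TopologicalSpace A] [PreconnectedSpace A]
    [Nonempty A] {u : A → ℂ} (hu : Continuous u) (h : ∀ a, Complex.exp (u a) = 1) :
    ∃ d : ℤ, ∀ a, u a = d * (2 * Real.pi * Complex.I) := by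
  have hne : (2 * Real.pi * Complex.I : ℂ) ≠ 0 := Complex.two_pi_I_ne_zero
  have h' : ∀ a, ∃ d : ℤ, u a = d * (2 * Real.pi * Complex.I) := fun a =>
    Complex.exp_eq_one_iff.1 (h a)
  choose d hd using h'
  have hd' : ∀ a, (d a : ℝ) = (u a / (2 * Real.pi * Complex.I)).re := fun a => by
    rw [hd a, mul_div_cancel_right₀ _ hne]; simp
  have hc : Continuous d := by
    have h1 : Continuous fun a => (d a : ℝ) := by
      simp_rw [hd']
      exact Complex.continuous_re.comp (hu.div_const _)
    exact (Int.isClosedEmbedding_coe_real.isEmbedding.continuous_iff).2 h1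
  have a₀ : A := Classical.arbitrary A
  refine ⟨d a₀, fun a => ?_⟩
  rw [hd a, PreconnectedSpace.constant inferInstance hc (x := a) (y := a₀)]

lemma HasWinding.unique {f : ℝ → ℂ} {d e : ℤ} (hd : HasWinding f d) (he : HasWinding f e) :
    d = e := by
  obtain ⟨h, hc, hf, hp⟩ := hd
  obtain ⟨k, kc, kf, kp⟩ := he
  obtain ⟨m, hm⟩ := exists_eq_int_mul_of_exp_eq_one (u := fun t => h t - k t) (hc.sub kc)
    (fun t => by rw [Complex.exp_sub, ← hf, ← kf, div_self]; rw [hf]; exact Complex.exp_ne_zero _)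
  have h1 := hm 0
  have h2 := hm (0 + 2 * Real.pi)
  simp only [hp, kp] at h1 h2
  have h3 : ((d : ℂ) - e) * (2 * Real.pi * Complex.I) = 0 := by linear_combination h2 - h1
  rcases mul_eq_zero.1 h3 with h4 | h4
  · exact_mod_cast sub_eq_zero.1 h4
  · exact absurd h4 Complex.two_pi_I_ne_zero

lemma HasWinding.mul {f g : ℝ → ℂ} {d e : ℤ} (hd : HasWinding f d) (he : HasWinding g e) :
    HasWinding (fun t => f t * g t) (d + e) := by
  obtain ⟨h, hc, hf, hp⟩ := hd
  obtain ⟨k, kc, kf, kp⟩ := he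
  refine ⟨fun t => h t + k t, hc.add kc, fun t => by simp only [Complex.exp_add, hf, kf],
    fun t => ?_⟩
  simp only [hp, kp]; push_cast; ring

lemma hasWinding_const {c : ℂ} (hc : c ≠ 0) : HasWinding (fun _ => c) 0 :=
  ⟨fun _ => Complex.log c, continuous_const, fun _ => (Complex.exp_log hc).symm, by simp⟩

lemma HasWinding.prod {ι : Type*} (s : Finset ι) {f : ι → ℝ → ℂ} {d : ι → ℤ}
    (h : ∀ i ∈ s, HasWinding (f i) (d i)) :
    HasWinding (fun t => ∏ i ∈ s, f i t) (∑ i ∈ s, d i) := by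
  classical
  induction s using Finset.induction_on with
  | empty => simpa using hasWinding_const one_ne_zero
  | insert a s ha ih =>
    simp only [Finset.prod_insert ha, Finset.sum_insert ha]
    exact (h a (Finset.mem_insert_self a s)).mul
      (ih fun i hi => h i (Finset.mem_insert_of_mem hi))

lemma hasWinding_circle_pow {r : ℝ} (hr : 0 < r) (n : ℕ) :
    HasWinding (fun t => ((r : ℂ) * Complex.exp (t * Complex.I)) ^ n) n := by
  refine ⟨fun t => n * (Complex.log r + t * Complex.I), by fun_prop, fun t => ?_, fun t => ?_⟩
  · rw [Complex.exp_nat_mul, Complex.exp_add, Complex.exp_log (by exact_mod_cast hr.ne')]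
  · push_cast; ring

/-- Homotopy invariance of the winding number, for a family of loops parametrised by the line. The
logarithm of the whole family exists because the parameter plane is simply connected. -/
lemma exists_forall_hasWinding_line {F : ℝ → ℝ → ℂ} (hF : Continuous fun x : ℝ × ℝ => F x.1 x.2)
    (h0 : ∀ a t, F a t ≠ 0) (hp : ∀ a t, F a (t + 2 * Real.pi) = F a t) :
    ∃ d : ℤ, ∀ a, HasWinding (F a) d := by
  let f : C(ℝ × ℝ, {z : ℂ // z ≠ 0}) := ⟨fun x => ⟨F x.1 x.2, h0 _ _⟩, hF.subtype_mk _⟩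
  obtain ⟨h, ⟨-, hh⟩, -⟩ := Complex.isCoveringMap_exp.existsUnique_continuousMap_lifts f
    (a₀ := (0, 0)) (e₀ := Complex.log (F 0 0)) (Subtype.ext (Complex.exp_log (h0 0 0)))
  have hexp : ∀ a t, F a t = Complex.exp (h (a, t)) := fun a t =>
    (congrArg Subtype.val (congrFun hh (a, t))).symm
  obtain ⟨d, hd⟩ := exists_eq_int_mul_of_exp_eq_one
    (u := fun x : ℝ × ℝ => h (x.1, x.2 + 2 * Real.pi) - h (x.1, x.2)) (by fun_prop) (fun x => by
      rw [Complex.exp_sub, ← hexp, ← hexp, hp, div_self (h0 _ _)])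
  refine ⟨d, fun a => ⟨fun t => h (a, t), by fun_prop, hexp a, fun t => ?_⟩⟩
  rw [← hd (a, t)]; ring

/-- Homotopy invariance of the winding number, for a family of loops parametrised by a convex
set. -/
lemma exists_forall_hasWinding {E : Type*} [NormedAddCommGroup E] [NormedSpace ℝ E] {S : Set E}
    (hS : Convex ℝ S) {F : E → ℝ → ℂ}
    (hF : ContinuousOn (fun x : E × ℝ => F x.1 x.2) (S ×ˢ Set.univ))
    (h0 : ∀ a ∈ S, ∀ t, F a t ≠ 0) (hp : ∀ a ∈ S, ∀ t, F a (t + 2 * Real.pi) = F a t) :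
    ∃ d : ℤ, ∀ a ∈ S, HasWinding (F a) d := by
  rcases S.eq_empty_or_nonempty with rfl | ⟨a₀, ha₀⟩
  · exact ⟨0, by simp⟩
  have key : ∀ a ∈ S, ∃ d, HasWinding (F a₀) d ∧ HasWinding (F a) d := by
    intro a ha
    -- the parameter runs along the segment from `a₀` to `a`
    let c : ℝ → E := fun τ => AffineMap.lineMap a₀ a (Set.projIcc (0 : ℝ) 1 zero_le_one τ : ℝ)
    have hc : Continuous c := by
      have : Continuous fun τ : ℝ => (Set.projIcc (0 : ℝ) 1 zero_le_one τ : ℝ) :=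
        continuous_subtype_val.comp continuous_projIcc
      exact AffineMap.lineMap_continuous.comp this
    have hcS : ∀ τ, c τ ∈ S := fun τ => hS.segment_subset ha₀ ha (by
      rw [segment_eq_image_lineMap]
      exact ⟨_, (Set.projIcc (0 : ℝ) 1 zero_le_one τ).2, rfl⟩)
    obtain ⟨d, hd⟩ := exists_forall_hasWinding_line (F := fun τ t => F (c τ) t)
      (hF.comp_continuous (f := fun x : ℝ × ℝ => (c x.1, x.2)) (by fun_prop)
        fun x => ⟨hcS _, trivial⟩) (fun τ => h0 _ (hcS τ)) (fun τ => hp _ (hcS τ))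
    have e0 : c 0 = a₀ := by simp [c]
    have e1 : c 1 = a := by simp [c]
    exact ⟨d, e0 ▸ hd 0, e1 ▸ hd 1⟩
  obtain ⟨d, hd, -⟩ := key a₀ ha₀
  refine ⟨d, fun a ha => ?_⟩
  obtain ⟨e, he, he'⟩ := key a ha
  rwa [hd.unique he]

/-- A loop which is invariant under rotation by `2π / q` has winding number divisible by `q`. -/
lemma HasWinding.dvd_of_rotate {f : ℝ → ℂ} {d : ℤ} (hd : HasWinding f d) {q : ℕ} (hq : 0 < q)
    (h : ∀ t, f (t + 2 * Real.pi / q) = f t) : (q : ℤ) ∣ d := by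
  obtain ⟨k, kc, kf, kp⟩ := hd
  obtain ⟨m, hm⟩ := exists_eq_int_mul_of_exp_eq_one
    (u := fun t => k (t + 2 * Real.pi / q) - k t) (by fun_prop) (fun t => by
      rw [Complex.exp_sub, ← kf, ← kf, h, div_self]; rw [kf]; exact Complex.exp_ne_zero _)
  have hj : ∀ j : ℕ, k (j * (2 * Real.pi / q)) = k 0 + j * (m * (2 * Real.pi * Complex.I)) := by
    intro j
    induction j with
    | zero => simp
    | succ j ih =>
      have := hm (j * (2 * Real.pi / q))
      rw [ih] at this
      have e : ((j + 1 : ℕ) : ℝ) * (2 * Real.pi / q) = j * (2 * Real.pi / q) + 2 * Real.pi / q := by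
        push_cast; ring
      rw [e]
      push_cast
      linear_combination this
  have hq' : (q : ℝ) ≠ 0 := by exact_mod_cast hq.ne'
  have h1 := hj q
  have h2 := kp 0
  rw [mul_div_cancel₀ _ hq', ← zero_add (2 * Real.pi), h2] at h1
  have h3 : ((d : ℂ) - q * m) * (2 * Real.pi * Complex.I) = 0 := by linear_combination h1
  rcases mul_eq_zero.1 h3 with h4 | h4
  · exact ⟨m, by exact_mod_cast sub_eq_zero.1 h4⟩
  · exact absurd h4 Complex.two_pi_I_ne_zero

/-- The circle of radius `r` around the origin. -/
def circleLoop (r t : ℝ) : ℂ := r * Complex.exp (t * Complex.I)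

lemma continuous_circleLoop : Continuous fun x : ℝ × ℝ => circleLoop x.1 x.2 := by
  unfold circleLoop; fun_prop

lemma norm_circleLoop {r : ℝ} (hr : 0 ≤ r) (t : ℝ) : ‖circleLoop r t‖ = r := by
  rw [circleLoop, norm_mul, Complex.norm_exp_ofReal_mul_I, mul_one, Complex.norm_real,
    Real.norm_of_nonneg hr]

lemma circleLoop_ne_zero {r : ℝ} (hr : 0 < r) (t : ℝ) : circleLoop r t ≠ 0 := by
  rw [← norm_pos_iff, norm_circleLoop hr.le]; exact hr

lemma circleLoop_add_two_pi (r t : ℝ) : circleLoop r (t + 2 * Real.pi) = circleLoop r t := by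
  have : (((t + 2 * Real.pi : ℝ) : ℂ) * Complex.I) = t * Complex.I + 2 * Real.pi * Complex.I := by
    push_cast; ring
  rw [circleLoop, circleLoop, this, Complex.exp_add, Complex.exp_two_pi_mul_I, mul_one]

/-- A function which extends continuously without zeros over the centre has winding number zero
on small circles. -/
lemma eventually_hasWinding_zero {g : ℂ → ℂ} {N : Set ℂ} (hN : N ∈ 𝓝 0) (hg : ContinuousOn g N)
    (h0 : g 0 ≠ 0) :
    ∀ᶠ r in 𝓝[>] (0 : ℝ), HasWinding (fun t => g (circleLoop r t)) 0 := by
  have hne : ∀ᶠ b in 𝓝 (0 : ℂ), g b ≠ 0 := (hg.continuousAt hN).eventually_ne h0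
  obtain ⟨ε, hε, hball⟩ := Metric.eventually_nhds_iff_ball.1 (hne.and hN)
  have hmem : ∀ r ∈ Set.Ico 0 ε, ∀ t, circleLoop r t ∈ Metric.ball (0 : ℂ) ε := fun r hr t => by
    rw [mem_ball_zero_iff, norm_circleLoop hr.1]; exact hr.2
  obtain ⟨d, hd⟩ := exists_forall_hasWinding (convex_Ico (0 : ℝ) ε)
    (F := fun r t => g (circleLoop r t))
    (hg.comp continuous_circleLoop.continuousOn
      fun x hx => (hball _ (hmem _ hx.1 _)).2)
    (fun r hr t => (hball _ (hmem r hr t)).1) (fun r _ t => by rw [circleLoop_add_two_pi])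
  have hd0 : d = 0 := (hd 0 ⟨le_rfl, hε⟩).unique (by
    simpa [circleLoop] using hasWinding_const h0)
  subst hd0
  filter_upwards [Ioo_mem_nhdsGT hε] with r hr using hd r ⟨hr.1.le, hr.2⟩

lemma eventually_circleLoop_mem {N : Set ℂ} (hN : N ∈ 𝓝 0) :
    ∀ᶠ r in 𝓝[>] (0 : ℝ), ∀ t, circleLoop r t ∈ N := by
  obtain ⟨ε, hε, hball⟩ := Metric.mem_nhds_iff.1 hN
  filter_upwards [Ioo_mem_nhdsGT hε] with r hr t
  exact hball (by rw [mem_ball_zero_iff, norm_circleLoop hr.1.le]; exact hr.2)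

/-! ### Corner determinants -/

section Corner

variable {n : Type*} [Fintype n] [DecidableEq n]

/-- The determinant of the compression of `A` to the range of the idempotent `P`. -/
def cornerDet (P A : Matrix n n ℂ) : ℂ := (1 - P + P * A * P).det

lemma cornerDet_mul_mul {P : Matrix n n ℂ} (hP : P * P = P) (A B : Matrix n n ℂ) :
    cornerDet P (A * P * B) = cornerDet P A * cornerDet P B := by
  rw [cornerDet, cornerDet, cornerDet, ← Matrix.det_mul]
  have e : ∀ C : Matrix n n ℂ, P * (P * C) = P * C := fun C => by rw [← mul_assoc, hP]
  congr 1
  simp only [mul_add, add_mul, mul_sub, sub_mul, mul_one, one_mul, mul_assoc, e, hP]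
  abel

lemma det_algEquiv (α : Matrix n n ℂ ≃ₐ[ℂ] Matrix n n ℂ) (A : Matrix n n ℂ) :
    (α A).det = A.det := by
  let β : Module.End ℂ (n → ℂ) ≃ₐ[ℂ] Module.End ℂ (n → ℂ) :=
    (Matrix.toLinAlgEquiv' (R := ℂ) (n := n)).symm.trans
      (α.trans (Matrix.toLinAlgEquiv' (R := ℂ) (n := n)))
  obtain ⟨T, hT⟩ := AlgEquiv.eq_linearEquivConjAlgEquiv β
  have h1 : Matrix.toLin' (α A) = β (Matrix.toLin' A) := by
    change Matrix.toLinAlgEquiv' (α A) = Matrix.toLinAlgEquiv' (α (Matrix.toLinAlgEquiv'.symm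
      (Matrix.toLinAlgEquiv' A)))
    rw [AlgEquiv.symm_apply_apply]
  rw [← LinearMap.det_toLin', h1, hT, ← LinearMap.det_toLin' A]
  exact LinearMap.det_conj (Matrix.toLin' A) T

lemma cornerDet_algEquiv (α : Matrix n n ℂ ≃ₐ[ℂ] Matrix n n ℂ) (P A : Matrix n n ℂ) :
    cornerDet (α P) (α A) = cornerDet P A := by
  rw [cornerDet, cornerDet, ← det_algEquiv α (1 - P + P * A * P)]
  simp

/-- The determinant of a block diagonal matrix. -/
lemma det_sum_corner {ι : Type*} (s : Finset ι) {Q : ι → Matrix n n ℂ}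
    (hQ : ∀ k ∈ s, Q k * Q k = Q k) (horth : ∀ k ∈ s, ∀ l ∈ s, k ≠ l → Q k * Q l = 0)
    (A : ι → Matrix n n ℂ) :
    (1 - ∑ k ∈ s, Q k + ∑ k ∈ s, Q k * A k * Q k).det = ∏ k ∈ s, cornerDet (Q k) (A k) := by
  classical
  induction s using Finset.induction_on with
  | empty => simp
  | insert m s hm ih =>
    rw [Finset.prod_insert hm, ← ih (fun k hk => hQ k (Finset.mem_insert_of_mem hk))
      (fun k hk l hl => horth k (Finset.mem_insert_of_mem hk) l (Finset.mem_insert_of_mem hl)),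
      cornerDet, ← Matrix.det_mul, Finset.sum_insert hm, Finset.sum_insert hm]
    have h1 : ∀ C : Matrix n n ℂ, Q m * (∑ k ∈ s, Q k * C) = 0 := fun C => by
      rw [Finset.mul_sum]
      refine Finset.sum_eq_zero fun k hk => ?_
      rw [← mul_assoc, horth m (Finset.mem_insert_self m s) k (Finset.mem_insert_of_mem hk)
        (fun h => hm (h ▸ hk)), zero_mul]
    have h2 : Q m * (∑ k ∈ s, Q k) = 0 := by simpa using h1 1
    have h3 : Q m * (∑ k ∈ s, Q k * A k * Q k) = 0 := by
      rw [Finset.mul_sum]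
      refine Finset.sum_eq_zero fun k hk => ?_
      rw [mul_assoc, ← mul_assoc, horth m (Finset.mem_insert_self m s) k
        (Finset.mem_insert_of_mem hk) (fun h => hm (h ▸ hk)), zero_mul]
    congr 1
    simp only [mul_add, add_mul, mul_sub, sub_mul, mul_one, one_mul, mul_assoc] at h2 h3 ⊢
    simp only [h2, h3, mul_zero]
    abel

/-- The spectral projection for the eigenvalue `1` of a matrix `X` with `X ^ q = 1`. -/
def avgPow (q : ℕ) (X : Matrix n n ℂ) : Matrix n n ℂ := (q : ℂ)⁻¹ • ∑ j ∈ Finset.range q, X ^ j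

lemma mul_avgPow {q : ℕ} {X : Matrix n n ℂ} (hX : X ^ q = 1) : X * avgPow q X = avgPow q X := by
  have h := Finset.sum_range_succ (fun j => X ^ j) q
  rw [Finset.sum_range_succ', hX, pow_zero] at h
  rw [avgPow, mul_smul_comm, Finset.mul_sum]
  simp only [← pow_succ', add_right_cancel h]

lemma pow_mul_avgPow {q : ℕ} {X : Matrix n n ℂ} (hX : X ^ q = 1) (j : ℕ) :
    X ^ j * avgPow q X = avgPow q X := by
  induction j with
  | zero => simp
  | succ j ih => rw [pow_succ, mul_assoc, mul_avgPow hX, ih]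

lemma avgPow_mul_self {q : ℕ} (hq : 0 < q) {X : Matrix n n ℂ} (hX : X ^ q = 1) :
    avgPow q X * avgPow q X = avgPow q X := by
  have hq' : (q : ℂ) ≠ 0 := by exact_mod_cast hq.ne'
  have h : avgPow q X * avgPow q X = (q : ℂ)⁻¹ • ∑ j ∈ Finset.range q, X ^ j * avgPow q X := by
    rw [← Finset.sum_mul, ← smul_mul_assoc]
    rfl
  rw [h]
  simp only [pow_mul_avgPow hX, Finset.sum_const, Finset.card_range]
  rw [← Nat.cast_smul_eq_nsmul ℂ, smul_smul, inv_mul_cancel₀ hq', one_smul]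

/-- Spectral projections for different eigenvalues are orthogonal. -/
lemma avgPow_smul_mul_avgPow_smul {q : ℕ} {X : Matrix n n ℂ} {c d : ℂ} (hc : (c • X) ^ q = 1)
    (hd : (d • X) ^ q = 1) (hcd : c ≠ d) : avgPow q (c • X) * avgPow q (d • X) = 0 := by
  set E := avgPow q (c • X) with hE
  set F := avgPow q (d • X) with hF
  have hEF : E * F = F * E := by
    have h1 : Commute (avgPow q (c • X)) (avgPow q (d • X)) := by
      unfold avgPow
      refine ((Commute.sum_left _ _ _ fun j _ => Commute.sum_right _ _ _ fun k _ => ?_).smul_left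
        _).smul_right _
      rw [smul_pow, smul_pow]
      exact ((Commute.pow_pow_self X j k).smul_right _).smul_left _
    exact h1.eq
  have h1 : c • (X * (E * F)) = E * F := by
    rw [← smul_mul_assoc, ← mul_assoc, mul_avgPow hc]
  have h2 : d • (X * (E * F)) = E * F := by
    rw [hEF, ← smul_mul_assoc, ← mul_assoc, mul_avgPow hd]
  have h3 : (c - d) • (X * (E * F)) = 0 := by rw [sub_smul, h1, h2, sub_self]
  rw [smul_eq_zero, sub_eq_zero] at h3
  rw [← h1, h3.resolve_left hcd, smul_zero]

lemma sum_avgPow_smul {q : ℕ} (hq : 0 < q) {ω : ℂ} (hω : IsPrimitiveRoot ω q)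
    (X : Matrix n n ℂ) : ∑ k ∈ Finset.range q, avgPow q (ω ^ k • X) = 1 := by
  have hq' : (q : ℂ) ≠ 0 := by exact_mod_cast hq.ne'
  simp only [avgPow, smul_pow, ← Finset.smul_sum]
  rw [Finset.sum_comm]
  simp only [← Finset.sum_smul]
  rw [Finset.sum_eq_single 0]
  · simp [smul_smul, hq', ← Nat.cast_smul_eq_nsmul ℂ]
  · intro j hj hj0
    have hj1 : ω ^ j ≠ 1 := hω.pow_ne_one_of_pos_of_lt hj0 (Finset.mem_range.1 hj)
    have : ∑ k ∈ Finset.range q, (ω ^ k) ^ j = 0 := by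
      have h := geom_sum_mul (ω ^ j) q
      rw [← pow_mul, mul_comm j, pow_mul, hω.pow_eq_one, one_pow, sub_self] at h
      simp only [← pow_mul, mul_comm _ j] at h ⊢
      exact (mul_eq_zero.1 h).resolve_right (sub_ne_zero.2 hj1)
    rw [this, zero_smul]
  · intro h; exact absurd (Finset.mem_range.2 hq) h

lemma mul_avgPow_of_comm {q : ℕ} {X Y V : Matrix n n ℂ} (h : V * X = Y * V) :
    V * avgPow q X = avgPow q Y * V := by
  have : ∀ j, V * X ^ j = Y ^ j * V := fun j => SemiconjBy.pow_right (a := V) h j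
  simp only [avgPow, mul_smul_comm, smul_mul_assoc, Finset.mul_sum, Finset.sum_mul, this]

lemma avgPow_algEquiv {q : ℕ} (α : Matrix n n ℂ ≃ₐ[ℂ] Matrix n n ℂ) (X : Matrix n n ℂ) :
    α (avgPow q X) = avgPow q (α X) := by simp [avgPow]

lemma ContinuousOn.avgPow {E : Type*} [TopologicalSpace E] {X : E → Matrix n n ℂ} {S : Set E}
    (hX : ContinuousOn X S) (q : ℕ) : ContinuousOn (fun y => avgPow q (X y)) S := by
  unfold _root_.avgPow
  exact (continuousOn_const (c := (q : ℂ)⁻¹)).smul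
    (continuousOn_finsetSum _ fun j _ => hX.pow j)

lemma ContinuousOn.cornerDet {E : Type*} [TopologicalSpace E] {P A : E → Matrix n n ℂ} {S : Set E}
    (hP : ContinuousOn P S) (hA : ContinuousOn A S) :
    ContinuousOn (fun y => cornerDet (P y) (A y)) S := by
  have h : ContinuousOn (fun y => 1 - P y + P y * A y * P y) S :=
    (continuousOn_const.sub hP).add ((hP.mul hA).mul hP)
  exact (continuous_id.matrix_det).comp_continuousOn h

end Corner

/-! ### The divisibility for matrix-valued functions near the core circle -/

/-- The matrix form of the generators over an open piece `W` of the solid torus, in the coordinates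
`(s, b)`, where `s` is an angle along the `q`-fold cover of the core circle and `b` is a `q`-th root
of the transversal coordinate. The eigenvalues of `X` are powers of `ω`, and off the core circle
`b = 0` the matrix `V` permutes the eigenspaces cyclically. Shifting `s` by `σ` leads to the same
point, with `X` replaced by `ω X`; rotating `b` by `2π / q` leads to the same point with the same
matrices. -/
structure RotationChart (q n : ℕ) (ω : ℂ) (σ : ℝ) where
  W : Set (ℝ × ℂ)
  X : ℝ × ℂ → Matrix (Fin n) (Fin n) ℂ
  V : ℝ × ℂ → Matrix (Fin n) (Fin n) ℂ
  isOpen : IsOpen W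
  continuousOn_X : ContinuousOn X W
  continuousOn_V : ContinuousOn V W
  comm : ∀ y ∈ W, V y * X y = ω • (X y * V y)
  X_pow : ∀ y ∈ W, X y ^ q = 1
  V_pow : ∀ y ∈ W, V y ^ q = y.2 ^ q • (1 : Matrix (Fin n) (Fin n) ℂ)
  star_V_mul_V : ∀ y ∈ W, star (V y) * V y = ((‖y.2‖ : ℂ) ^ 2) • (1 : Matrix (Fin n) (Fin n) ℂ)
  shift_mem : ∀ s b, (s, b) ∈ W → (s + σ, b) ∈ W
  shift_X : ∀ s b, (s, b) ∈ W → X (s + σ, b) = ω • X (s, b)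
  shift_V : ∀ s b, (s, b) ∈ W → V (s + σ, b) = V (s, b)
  rotate_X : ∀ s b, (s, b) ∈ W → X (s, Complex.exp (2 * Real.pi * Complex.I / q) * b) = X (s, b)
  rotate_V : ∀ s b, (s, b) ∈ W → V (s, Complex.exp (2 * Real.pi * Complex.I / q) * b) = V (s, b)

namespace RotationChart

variable {q n : ℕ} {ω : ℂ} {σ : ℝ}

/-- The spectral projection of `X` for the eigenvalue `ω ^ (-k)`. -/
def proj (C : RotationChart q n ω σ) (k : ℕ) (y : ℝ × ℂ) : Matrix (Fin n) (Fin n) ℂ :=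
  avgPow q (ω ^ k • C.X y)

/-- The determinant of `V`, as a map from the range of `C.proj k` to that of `C.proj (k + 1)`, when
the two are compared by means of the matrix `G`. -/
def cornerV (C : RotationChart q n ω σ) (k : ℕ) (G : Matrix (Fin n) (Fin n) ℂ) (y : ℝ × ℂ) : ℂ :=
  cornerDet (C.proj k y) (G * C.V y)

/-- If this function does not vanish, then `G` and `H` identify the ranges of `C.proj k` and
`C.proj (k + 1)`. Unlike `C.cornerV`, it can be nonzero on the core circle. -/
def link (C : RotationChart q n ω σ) (k : ℕ) (G H : Matrix (Fin n) (Fin n) ℂ) (y : ℝ × ℂ) : ℂ :=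
  cornerDet (C.proj k y) (G * C.proj (k + 1) y * H)

variable (C : RotationChart q n ω σ)

lemma smul_X_pow (hω : ω ^ q = 1) {y : ℝ × ℂ} (hy : y ∈ C.W) (k : ℕ) : (ω ^ k • C.X y) ^ q = 1 := by
  rw [smul_pow, C.X_pow y hy, ← pow_mul, mul_comm, pow_mul, hω, one_pow, one_smul]

lemma proj_mul_self (hq : 0 < q) (hω : ω ^ q = 1) {y : ℝ × ℂ} (hy : y ∈ C.W) (k : ℕ) :
    C.proj k y * C.proj k y = C.proj k y :=
  avgPow_mul_self hq (C.smul_X_pow hω hy k)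

lemma V_mul_proj {y : ℝ × ℂ} (hy : y ∈ C.W) (k : ℕ) :
    C.V y * C.proj k y = C.proj (k + 1) y * C.V y := by
  refine mul_avgPow_of_comm ?_
  rw [mul_smul_comm, C.comm y hy, smul_smul, ← pow_succ, smul_mul_assoc]

lemma isUnit_V {y : ℝ × ℂ} (hy : y ∈ C.W) (hb : y.2 ≠ 0) : IsUnit (C.V y).det := by
  have h := congrArg Matrix.det (C.star_V_mul_V y hy)
  rw [Matrix.det_mul, Matrix.det_smul, Matrix.det_one, mul_one] at h
  refine isUnit_iff_ne_zero.2 fun h0 => ?_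
  rw [h0, mul_zero] at h
  have : (‖y.2‖ : ℂ) ≠ 0 := by exact_mod_cast norm_ne_zero_iff.2 hb
  exact pow_ne_zero _ (pow_ne_zero _ this) h.symm

/-- Off the core circle, `V` itself identifies the two ranges, and determinants are
multiplicative. -/
lemma link_eq (hq : 0 < q) (hω : ω ^ q = 1) {y : ℝ × ℂ} (hy : y ∈ C.W) (hb : y.2 ≠ 0) (k : ℕ)
    (G H : Matrix (Fin n) (Fin n) ℂ) :
    C.link k G H y = C.cornerV k G y * cornerDet (C.proj k y) ((C.V y)⁻¹ * H) := by
  rw [cornerV, ← cornerDet_mul_mul (C.proj_mul_self hq hω hy k), link]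
  congr 1
  have h : C.V y * C.proj k y * (C.V y)⁻¹ = C.proj (k + 1) y := by
    rw [C.V_mul_proj hy, mul_assoc, Matrix.mul_nonsing_inv _ (C.isUnit_V hy hb), mul_one]
  rw [← h]
  simp only [mul_assoc]

lemma continuousOn_proj (k : ℕ) : ContinuousOn (C.proj k) C.W :=
  (C.continuousOn_X.const_smul (ω ^ k)).avgPow q

lemma continuousOn_cornerV (k : ℕ) {S : Set (ℝ × ℂ)} (hS : S ⊆ C.W)
    {G : ℝ × ℂ → Matrix (Fin n) (Fin n) ℂ} (hG : ContinuousOn G S) :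
    ContinuousOn (fun y => C.cornerV k (G y) y) S :=
  ((C.continuousOn_proj k).mono hS).cornerDet (hG.mul (C.continuousOn_V.mono hS))

lemma continuousOn_link (k : ℕ) {S : Set (ℝ × ℂ)} (hS : S ⊆ C.W)
    {G H : ℝ × ℂ → Matrix (Fin n) (Fin n) ℂ} (hG : ContinuousOn G S) (hH : ContinuousOn H S) :
    ContinuousOn (fun y => C.link k (G y) (H y) y) S :=
  ((C.continuousOn_proj k).mono hS).cornerDet
    ((hG.mul ((C.continuousOn_proj (k + 1)).mono hS)).mul hH)

lemma shift_mul {s : ℝ} {b : ℂ} (h : (s, b) ∈ C.W) (k : ℕ) :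
    (s + k * σ, b) ∈ C.W ∧ C.X (s + k * σ, b) = ω ^ k • C.X (s, b) ∧
      C.V (s + k * σ, b) = C.V (s, b) := by
  induction k with
  | zero => simpa using h
  | succ k ih =>
    have e : s + ((k + 1 : ℕ) : ℝ) * σ = s + k * σ + σ := by push_cast; ring
    rw [e]
    refine ⟨C.shift_mem _ _ ih.1, ?_, ?_⟩
    · rw [C.shift_X _ _ ih.1, ih.2.1, smul_smul, pow_succ']
    · rw [C.shift_V _ _ ih.1, ih.2.2]

lemma proj_shift {s : ℝ} {b : ℂ} (h : (s, b) ∈ C.W) (k j : ℕ) :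
    C.proj j (s + k * σ, b) = C.proj (k + j) (s, b) := by
  rw [proj, proj, (C.shift_mul h k).2.1, smul_smul, ← pow_add, add_comm]

lemma cornerV_shift {s : ℝ} {b : ℂ} (h : (s, b) ∈ C.W) (k : ℕ) (G : Matrix (Fin n) (Fin n) ℂ) :
    C.cornerV 0 G (s + k * σ, b) = C.cornerV k G (s, b) := by
  rw [cornerV, cornerV, C.proj_shift h, (C.shift_mul h k).2.2, add_zero]

lemma link_shift {s : ℝ} {b : ℂ} (h : (s, b) ∈ C.W) (k : ℕ) (G H : Matrix (Fin n) (Fin n) ℂ) :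
    C.link 0 G H (s + k * σ, b) = C.link k G H (s, b) := by
  rw [link, link, C.proj_shift h, C.proj_shift h, add_zero, zero_add]

open scoped Matrix.Norms.L2Operator in
/-- On the core circle the ranges of consecutive spectral projections can be identified. The
identification is given by `V` at a nearby point off the core circle; there `V` is a multiple of a
unitary, so that conjugation by it does not magnify the error. -/
lemma exists_link_ne_zero (hq : 0 < q) (hω : ω ^ q = 1) {s : ℝ} (hs : (s, 0) ∈ C.W) :
    ∃ G H, ∀ k < q, C.link k G H (s, 0) ≠ 0 := by
  have hne : (𝓝[≠] (0 : ℂ)).NeBot := inferInstance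
  have hpath : Filter.Tendsto (fun b : ℂ => (s, b)) (𝓝[≠] 0) (𝓝 (s, 0)) :=
    ((Continuous.prodMk_right s).tendsto 0).mono_left nhdsWithin_le_nhds
  have hWev : ∀ᶠ b in 𝓝[≠] (0 : ℂ), (s, b) ∈ C.W := hpath (C.isOpen.mem_nhds hs)
  have hproj : ∀ k, Filter.Tendsto (fun b : ℂ => C.proj k (s, b)) (𝓝[≠] 0) (𝓝 (C.proj k (s, 0))) :=
    fun k => ((C.continuousOn_proj k).continuousAt (C.isOpen.mem_nhds hs)).tendsto.comp hpath
  suffices h : ∀ k, ∀ᶠ b in 𝓝[≠] (0 : ℂ), C.link k (C.V (s, b))⁻¹ (C.V (s, b)) (s, 0) ≠ 0 by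
    obtain ⟨b, hb⟩ := ((Filter.eventually_all_finset (Finset.range q)).2 fun k _ => h k).exists
    exact ⟨_, _, fun k hk => hb k (Finset.mem_range.2 hk)⟩
  intro k
  have hdiff : Filter.Tendsto (fun b : ℂ => (C.V (s, b))⁻¹ * C.proj (k + 1) (s, 0) * C.V (s, b) -
      C.proj k (s, b)) (𝓝[≠] 0) (𝓝 0) := by
    have h0 : Filter.Tendsto (fun b : ℂ => ‖C.proj (k + 1) (s, 0) - C.proj (k + 1) (s, b)‖)
        (𝓝[≠] 0) (𝓝 0) := by
      have := ((tendsto_const_nhds (x := C.proj (k + 1) (s, 0))).sub (hproj (k + 1))).norm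
      rwa [sub_self, norm_zero] at this
    refine squeeze_zero_norm' ?_ h0
    filter_upwards [hWev, self_mem_nhdsWithin] with b hbW hb
    have hU := C.isUnit_V hbW hb
    have h1 : C.proj k (s, b) = (C.V (s, b))⁻¹ * C.proj (k + 1) (s, b) * C.V (s, b) := by
      rw [mul_assoc, ← C.V_mul_proj hbW, ← mul_assoc, Matrix.nonsing_inv_mul _ hU, one_mul]
    rw [h1, ← sub_mul, ← mul_sub]
    have hb0 : ‖b‖ ≠ 0 := norm_ne_zero_iff.2 hb
    have hbC : (‖b‖ : ℂ) ≠ 0 := by exact_mod_cast hb0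
    have hstar := C.star_V_mul_V (s, b) hbW
    have hinv : (C.V (s, b))⁻¹ = ((‖b‖ : ℂ) ^ 2)⁻¹ • star (C.V (s, b)) := by
      refine Matrix.inv_eq_left_inv ?_
      rw [smul_mul_assoc, hstar, smul_smul, inv_mul_cancel₀ (pow_ne_zero 2 hbC), one_smul]
    have hnormV : ‖C.V (s, b)‖ * ‖C.V (s, b)‖ ≤ ‖b‖ ^ 2 := by
      rw [← CStarRing.norm_star_mul_self, hstar, norm_smul, norm_pow, Complex.norm_real, norm_norm]
      refine mul_le_of_le_one_right (by positivity) ?_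
      rcases isEmpty_or_nonempty (Fin n) with hn | hn
      · rw [Subsingleton.elim (1 : Matrix (Fin n) (Fin n) ℂ) 0, norm_zero]; exact zero_le_one
      · exact CStarRing.norm_one.le
    set D := C.proj (k + 1) (s, 0) - C.proj (k + 1) (s, b)
    calc ‖(C.V (s, b))⁻¹ * D * C.V (s, b)‖
        ≤ ‖(C.V (s, b))⁻¹‖ * ‖D‖ * ‖C.V (s, b)‖ :=
          (norm_mul_le _ _).trans (mul_le_mul_of_nonneg_right (norm_mul_le _ _) (norm_nonneg _))
      _ = ((‖b‖ ^ 2)⁻¹ * (‖C.V (s, b)‖ * ‖C.V (s, b)‖)) * ‖D‖ := by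
          rw [hinv, norm_smul, norm_star, norm_inv, norm_pow, Complex.norm_real, norm_norm]; ring
      _ ≤ ((‖b‖ ^ 2)⁻¹ * ‖b‖ ^ 2) * ‖D‖ := by gcongr
      _ = ‖D‖ := by rw [inv_mul_cancel₀ (pow_ne_zero 2 hb0), one_mul]
  have hconj : Filter.Tendsto (fun b : ℂ => (C.V (s, b))⁻¹ * C.proj (k + 1) (s, 0) * C.V (s, b))
      (𝓝[≠] 0) (𝓝 (C.proj k (s, 0))) := by
    simpa using hdiff.add (hproj k)
  have hcont : Continuous fun A => cornerDet (C.proj k (s, 0)) A := by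
    rw [← continuousOn_univ]
    exact continuousOn_const.cornerDet continuousOn_id
  have hlim := (hcont.tendsto _).comp hconj
  refine hlim.eventually_ne ?_
  rw [cornerDet, C.proj_mul_self hq hω hs, C.proj_mul_self hq hω hs, sub_add_cancel,
    Matrix.det_one]
  exact one_ne_zero

/-- Near a point of the core circle where `G` and `H` identify the ranges of the projections, the
winding number of `C.cornerV k G` on small transversal circles does not depend on the circle. -/
lemma exists_eventually_hasWinding (hq : 0 < q) (hω : ω ^ q = 1) {s₀ : ℝ} (hs : (s₀, 0) ∈ C.W)
    {k : ℕ} {G H : Matrix (Fin n) (Fin n) ℂ} (h0 : C.link k G H (s₀, 0) ≠ 0) :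
    ∃ d : ℤ, ∀ᶠ s in 𝓝 s₀, ((s, 0) ∈ C.W ∧ C.link k G H (s, 0) ≠ 0) ∧
      ∀ᶠ r in 𝓝[>] (0 : ℝ), HasWinding (fun t => C.cornerV k G (s, circleLoop r t)) d := by
  have hW := C.isOpen.mem_nhds hs
  have hev : ∀ᶠ y in 𝓝 (s₀, (0 : ℂ)), y ∈ C.W ∧ C.link k G H y ≠ 0 :=
    (Filter.Eventually.and hW (((C.continuousOn_link k subset_rfl (continuousOn_const (c := G))
      (continuousOn_const (c := H))).continuousAt hW).eventually_ne h0))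
  obtain ⟨ε, hε, hball⟩ := Metric.eventually_nhds_iff_ball.1 hev
  have hmem : ∀ s ∈ Metric.ball s₀ ε, ∀ b : ℂ, ‖b‖ < ε → (s, b) ∈ C.W ∧ C.link k G H (s, b) ≠ 0 :=
    fun s hs b hb => hball _ (by
      rw [← ball_prod_same]
      exact ⟨hs, by simpa using hb⟩)
  have hmem' : ∀ a ∈ Metric.ball s₀ ε ×ˢ Set.Ioo 0 ε, ∀ t,
      (a.1, circleLoop a.2 t) ∈ C.W ∧ C.link k G H (a.1, circleLoop a.2 t) ≠ 0 := fun a ha t =>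
    hmem _ ha.1 _ (by rw [norm_circleLoop ha.2.1.le]; exact ha.2.2)
  obtain ⟨d, hd⟩ := exists_forall_hasWinding ((convex_ball s₀ ε).prod (convex_Ioo 0 ε))
    (F := fun a t => C.cornerV k G (a.1, circleLoop a.2 t))
    ((C.continuousOn_cornerV k subset_rfl (continuousOn_const (c := G))).comp
      (f := fun x : (ℝ × ℝ) × ℝ => (x.1.1, circleLoop x.1.2 x.2))
      (Continuous.continuousOn (by
        have := continuous_circleLoop
        fun_prop)) fun x hx => (hmem' _ hx.1 _).1)
    (fun a ha t hz => (hmem' a ha t).2 (by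
      rw [C.link_eq hq hω (hmem' a ha t).1 (circleLoop_ne_zero ha.2.1 t), hz, zero_mul]))
    (fun a _ t => by rw [circleLoop_add_two_pi])
  refine ⟨d, ?_⟩
  filter_upwards [Metric.ball_mem_nhds s₀ hε] with s hs
  refine ⟨hmem s hs 0 (by simpa using hε), ?_⟩
  filter_upwards [Ioo_mem_nhdsGT hε] with r hr using hd (s, r) ⟨hs, hr⟩

/-- Two charts describe the same bundle: on their overlap they differ by a continuous family of
automorphisms of the matrix algebra. -/
def Compatible (C C' : RotationChart q n ω σ) : Prop :=
  ∃ α : ℝ × ℂ → (Matrix (Fin n) (Fin n) ℂ ≃ₐ[ℂ] Matrix (Fin n) (Fin n) ℂ),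
    (∀ y ∈ C.W ∩ C'.W, α y (C'.X y) = C.X y ∧ α y (C'.V y) = C.V y) ∧
      ∀ G, ContinuousOn (fun y => α y G) (C.W ∩ C'.W)

/-- The winding number of `cornerV` depends neither on the chart nor on the identification. -/
lemma Compatible.winding_unique {C C' : RotationChart q n ω σ} (hC : C.Compatible C') (hq : 0 < q)
    (hω : ω ^ q = 1) {s : ℝ} (hs : (s, 0) ∈ C.W) (hs' : (s, 0) ∈ C'.W) {k : ℕ}
    {G H G' H' : Matrix (Fin n) (Fin n) ℂ}
    (h0 : C.link k G H (s, 0) ≠ 0) (h0' : C'.link k G' H' (s, 0) ≠ 0) {d d' : ℤ}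
    (hd : ∀ᶠ r in 𝓝[>] (0 : ℝ), HasWinding (fun t => C.cornerV k G (s, circleLoop r t)) d)
    (hd' : ∀ᶠ r in 𝓝[>] (0 : ℝ), HasWinding (fun t => C'.cornerV k G' (s, circleLoop r t)) d') :
    d = d' := by
  obtain ⟨α, hα, hαc⟩ := hC
  have hproj : ∀ y ∈ C.W ∩ C'.W, ∀ j, α y (C'.proj j y) = C.proj j y := fun y hy j => by
    rw [proj, avgPow_algEquiv, map_smul, (hα y hy).1, proj]
  have hlink : ∀ y ∈ C.W ∩ C'.W, C.link k (α y G') (α y H') y = C'.link k G' H' y := fun y hy => by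
    rw [link, link, ← cornerDet_algEquiv (α y) (C'.proj k y), hproj y hy, map_mul, map_mul,
      hproj y hy]
  have hcor : ∀ y ∈ C.W ∩ C'.W, C.cornerV k (α y G') y = C'.cornerV k G' y := fun y hy => by
    rw [cornerV, cornerV, ← cornerDet_algEquiv (α y) (C'.proj k y), hproj y hy, map_mul,
      (hα y hy).2]
  -- the transversal disc through the given point of the core circle
  set N : Set ℂ := {b | (s, b) ∈ C.W ∩ C'.W} with hNdef
  have hpath : Continuous fun b : ℂ => (s, b) := by fun_prop
  have hN : N ∈ 𝓝 (0 : ℂ) := ((C.isOpen.inter C'.isOpen).preimage hpath).mem_nhds ⟨hs, hs'⟩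
  have hcl : ∀ A B : ℝ × ℂ → Matrix (Fin n) (Fin n) ℂ, ContinuousOn A (C.W ∩ C'.W) →
      ContinuousOn B (C.W ∩ C'.W) →
      ContinuousOn (fun b : ℂ => C.link k (A (s, b)) (B (s, b)) (s, b)) N := fun A B hA hB =>
    (C.continuousOn_link k Set.inter_subset_left hA hB).comp hpath.continuousOn fun b hb => hb
  have c1 := hcl (fun _ => G) (fun _ => H) continuousOn_const continuousOn_const
  have c2 := hcl (fun y => α y G') (fun y => α y H') (hαc G') (hαc H')
  have c3 := hcl (fun y => α y G') (fun _ => H) (hαc G') continuousOn_const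
  have c4 := hcl (fun _ => G) (fun y => α y H') continuousOn_const (hαc H')
  -- the two identifications can be mixed; off the core circle this is multiplicativity
  have hmix : C.link k G H (s, 0) * C.link k (α (s, 0) G') (α (s, 0) H') (s, 0) =
      C.link k (α (s, 0) G') H (s, 0) * C.link k G (α (s, 0) H') (s, 0) := by
    have t1 := ((c1.mul c2).continuousAt hN).tendsto.mono_left
      (nhdsWithin_le_nhds (s := {(0 : ℂ)}ᶜ))
    have t2 := ((c3.mul c4).continuousAt hN).tendsto.mono_left
      (nhdsWithin_le_nhds (s := {(0 : ℂ)}ᶜ))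
    refine tendsto_nhds_unique_of_eventuallyEq t1 t2 ?_
    filter_upwards [nhdsWithin_le_nhds hN, self_mem_nhdsWithin] with b hbN hb
    simp only [Pi.mul_apply]
    rw [C.link_eq hq hω hbN.1 hb, C.link_eq hq hω hbN.1 hb, C.link_eq hq hω hbN.1 hb,
      C.link_eq hq hω hbN.1 hb]
    ring
  have h3 : C.link k (α (s, 0) G') H (s, 0) ≠ 0 := by
    rw [hlink _ ⟨hs, hs'⟩] at hmix
    exact left_ne_zero_of_mul (hmix ▸ mul_ne_zero h0 h0')
  have hsmall : ∀ᶠ r in 𝓝[>] (0 : ℝ), ∀ t, circleLoop r t ∈ N :=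
    eventually_circleLoop_mem hN
  obtain ⟨r, hw, hw', hw1, hw3, hr, hr0⟩ := (hd.and (hd'.and ((eventually_hasWinding_zero hN c1
    h0).and ((eventually_hasWinding_zero hN c3 h3).and
      (hsmall.and self_mem_nhdsWithin))))).exists
  have e1 := hw.mul hw3
  have e2 := hw'.mul hw1
  have e : (fun t => C.cornerV k G (s, circleLoop r t) *
      C.link k (α (s, circleLoop r t) G') H (s, circleLoop r t)) = fun t =>
      C'.cornerV k G' (s, circleLoop r t) * C.link k G H (s, circleLoop r t) := by
    funext t
    rw [← hcor _ (hr t), C.link_eq hq hω (hr t).1 (circleLoop_ne_zero hr0 t),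
      C.link_eq hq hω (hr t).1 (circleLoop_ne_zero hr0 t)]
    ring
  rw [e] at e1
  have := e1.unique e2
  simpa using this

end RotationChart

/-- The winding number `d` of `V`, restricted to one eigenspace of `X`, on small circles around the
core circle is independent of the point of the core circle, and hence of the eigenspace. Summing
over the eigenspaces yields `q * d = n`, and `d` is divisible by `q` because `V` depends only on the
`q`-th power of the coordinate of the circle. -/
theorem sq_dvd_of_rotationChart_cover {q n : ℕ} {ω : ℂ} {σ : ℝ} (hq : 0 < q)
    (hω : IsPrimitiveRoot ω q) {ι : Type*} (C : ι → RotationChart q n ω σ)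
    (hcover : ∀ s, ∃ i, (s, 0) ∈ (C i).W) (hcompat : ∀ i j, (C i).Compatible (C j)) :
    q ^ 2 ∣ n := by
  have hω1 := hω.pow_eq_one
  -- `J s d`: the transversal winding number at the angle `s` is `d`
  let J : ℝ → ℤ → Prop := fun s d => ∃ i G H, (s, 0) ∈ (C i).W ∧ (C i).link 0 G H (s, 0) ≠ 0 ∧
    ∀ᶠ r in 𝓝[>] (0 : ℝ), HasWinding (fun t => (C i).cornerV 0 G (s, circleLoop r t)) d
  have hJu : ∀ s d d', J s d → J s d' → d = d' := by
    rintro s d d' ⟨i, G, H, hs, h0, hd⟩ ⟨j, G', H', hs', h0', hd'⟩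
    exact (hcompat i j).winding_unique hq hω1 hs hs' h0 h0' hd hd'
  have hJe : ∀ s, ∃ d, ∀ᶠ s' in 𝓝 s, J s' d := by
    intro s
    obtain ⟨i, hi⟩ := hcover s
    obtain ⟨G, H, hGH⟩ := (C i).exists_link_ne_zero hq hω1 hi
    obtain ⟨d, hd⟩ := (C i).exists_eventually_hasWinding hq hω1 hi (hGH 0 hq)
    refine ⟨d, ?_⟩
    filter_upwards [hd] with s' hs' using ⟨i, G, H, hs'.1.1, hs'.1.2, hs'.2⟩
  choose D hD using hJe
  have hloc : IsLocallyConstant D := (IsLocallyConstant.iff_eventually_eq D).2 fun s => by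
    filter_upwards [hD s] with s' hs' using hJu s' _ _ (hD s').self_of_nhds hs'
  have hconst : ∀ s, J s (D 0) := fun s => by
    rw [hloc.apply_eq_of_preconnectedSpace 0 s]
    exact (hD s).self_of_nhds
  obtain ⟨i, hi⟩ := hcover 0
  obtain ⟨G, H, hGH⟩ := (C i).exists_link_ne_zero hq hω1 hi
  set c := C i with hc
  have hpath : Continuous fun b : ℂ => ((0 : ℝ), b) := by fun_prop
  set N : Set ℂ := {b | (0, b) ∈ c.W} with hNdef
  have hN : N ∈ 𝓝 (0 : ℂ) := (c.isOpen.preimage hpath).mem_nhds hi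
  have hsmall : ∀ᶠ r in 𝓝[>] (0 : ℝ), ∀ t, circleLoop r t ∈ N :=
    eventually_circleLoop_mem hN
  have hk : ∀ k ∈ Finset.range q, ∀ᶠ r in 𝓝[>] (0 : ℝ),
      HasWinding (fun t => c.cornerV k G (0, circleLoop r t)) (D 0) := by
    intro k hk
    obtain ⟨d, hd⟩ := c.exists_eventually_hasWinding hq hω1 hi (hGH k (Finset.mem_range.1 hk))
    have hd0 := hd.self_of_nhds
    -- the eigenspace with index `k` is the one with index `0` after `k` shifts
    have hJ : J (0 + k * σ) d := by
      refine ⟨i, G, H, (c.shift_mul hi k).1, ?_, ?_⟩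
      · rw [← hc, c.link_shift hi]; exact hd0.1.2
      · filter_upwards [hd0.2, hsmall] with r hr hr'
        rw [← hc]
        convert hr using 2 with t
        exact c.cornerV_shift (hr' t) k G
    rw [← hJu _ _ _ hJ (hconst _)]
    exact hd0.2
  -- the block matrix of the identifications, which is invertible on the core circle
  let Γ : ℂ → Matrix (Fin n) (Fin n) ℂ := fun b =>
    ∑ k ∈ Finset.range q, c.proj k (0, b) * G * c.proj (k + 1) (0, b)
  have horth : ∀ b ∈ N, ∀ j : ℕ, ∀ k ∈ Finset.range q, ∀ l ∈ Finset.range q, k ≠ l →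
      c.proj (k + j) (0, b) * c.proj (l + j) (0, b) = 0 := by
    intro b hb j k hk l hl hkl
    refine avgPow_smul_mul_avgPow_smul (c.smul_X_pow hω1 hb _) (c.smul_X_pow hω1 hb _) fun h => ?_
    rw [pow_add, pow_add] at h
    exact hkl (hω.pow_inj (Finset.mem_range.1 hk) (Finset.mem_range.1 hl)
      (mul_right_cancel₀ (pow_ne_zero j (hω.ne_zero hq.ne')) h))
  have hidem : ∀ b ∈ N, ∀ k, c.proj k (0, b) * c.proj k (0, b) = c.proj k (0, b) :=
    fun b hb k => c.proj_mul_self hq hω1 hb k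
  have hsum : ∀ b, ∑ k ∈ Finset.range q, c.proj k (0, b) = 1 := fun b => sum_avgPow_smul hq hω _
  have hblock : ∀ b ∈ N, ∀ A : ℕ → Matrix (Fin n) (Fin n) ℂ,
      (∑ k ∈ Finset.range q, c.proj k (0, b) * A k * c.proj k (0, b)).det =
        ∏ k ∈ Finset.range q, cornerDet (c.proj k (0, b)) (A k) := by
    intro b hb A
    rw [← det_sum_corner (Finset.range q) (fun k _ => hidem b hb k) (horth b hb 0) A, hsum,
      sub_self, zero_add]
  have hΓV : ∀ b ∈ N, (Γ b).det * (c.V (0, b)).det =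
      ∏ k ∈ Finset.range q, c.cornerV k G (0, b) := by
    intro b hb
    rw [← Matrix.det_mul]
    refine Eq.trans ?_ (hblock b hb fun _ => G * c.V (0, b))
    simp only [Γ, Finset.sum_mul]
    congr 1
    refine Finset.sum_congr rfl fun k _ => ?_
    rw [mul_assoc, ← c.V_mul_proj hb]
    simp only [mul_assoc]
  have hΓc : ContinuousOn (fun b => (Γ b).det) N := by
    refine (continuous_id.matrix_det).comp_continuousOn ?_
    have hp : ∀ k, ContinuousOn (fun b : ℂ => c.proj k (0, b)) N := fun k =>
      (c.continuousOn_proj k).comp hpath.continuousOn fun b hb => hb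
    exact continuousOn_finsetSum _ fun k _ => ((hp k).mul continuousOn_const).mul (hp (k + 1))
  have h0N : (0 : ℂ) ∈ N := hi
  have hΓ0 : (Γ 0).det ≠ 0 := by
    have h : Γ 0 * ∑ k ∈ Finset.range q, c.proj (k + 1) (0, 0) * H * c.proj k (0, 0) =
        ∑ k ∈ Finset.range q,
          c.proj k (0, 0) * (G * c.proj (k + 1) (0, 0) * H) * c.proj k (0, 0) := by
      simp only [Γ, Finset.sum_mul]
      refine Finset.sum_congr rfl fun k hk => ?_
      rw [Finset.mul_sum, Finset.sum_eq_single k]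
      · have := hidem 0 h0N (k + 1)
        calc _ = c.proj k (0, 0) * G * (c.proj (k + 1) (0, 0) * c.proj (k + 1) (0, 0)) * H *
              c.proj k (0, 0) := by simp only [mul_assoc]
          _ = _ := by rw [this]; simp only [mul_assoc]
      · intro l hl hlk
        have := horth 0 h0N 1 k hk l hl hlk.symm
        calc _ = c.proj k (0, 0) * G * (c.proj (k + 1) (0, 0) * c.proj (l + 1) (0, 0)) * H *
              c.proj l (0, 0) := by simp only [mul_assoc]
          _ = 0 := by rw [this]; simp
      · exact fun h => absurd hk h
    have hdet := congrArg Matrix.det h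
    rw [Matrix.det_mul, hblock 0 h0N fun k => G * c.proj (k + 1) (0, 0) * H] at hdet
    refine left_ne_zero_of_mul (hdet.trans_ne ?_)
    exact Finset.prod_ne_zero_iff.2 fun k hk => hGH k (Finset.mem_range.1 hk)
  obtain ⟨r, hw, hwΓ, hr, hr0⟩ := (((Filter.eventually_all_finset _).2 hk).and
    ((eventually_hasWinding_zero hN hΓc hΓ0).and (hsmall.and self_mem_nhdsWithin))).exists
  have hr0' : 0 < r := hr0
  -- compare the `q`-th powers, since `V ^ q` is scalar
  have w1 := HasWinding.prod (Finset.range q) fun _ _ => HasWinding.prod (Finset.range q) hw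
  have w2 := (HasWinding.prod (Finset.range q) fun _ _ => hwΓ).mul
    (hasWinding_circle_pow hr0' (q * n))
  have e : (fun t => ∏ _j ∈ Finset.range q, ∏ k ∈ Finset.range q,
      c.cornerV k G (0, circleLoop r t)) = fun t => (∏ _j ∈ Finset.range q,
        (Γ (circleLoop r t)).det) * ((r : ℂ) * Complex.exp (t * Complex.I)) ^ (q * n) := by
    funext t
    have hV := congrArg Matrix.det (c.V_pow _ (hr t))
    rw [Matrix.det_pow, Matrix.det_smul, Matrix.det_one, mul_one, Fintype.card_fin] at hV
    rw [← hΓV _ (hr t)]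
    simp only [Finset.prod_const, Finset.card_range, mul_pow, hV]
    rw [← mul_pow, pow_mul]
    rfl
  rw [e] at w1
  have hqd := w1.unique w2
  simp only [Finset.sum_const, Finset.card_range, nsmul_eq_mul, mul_zero, zero_add,
    Nat.cast_mul] at hqd
  have hqd' : (q : ℤ) * D 0 = n := mul_left_cancel₀ (by exact_mod_cast hq.ne') hqd
  have hdvd : (q : ℤ) ∣ D 0 := by
    refine (hw 0 (Finset.mem_range.2 hq)).dvd_of_rotate hq fun t => ?_
    have hrot : circleLoop r (t + 2 * Real.pi / q) =
        Complex.exp (2 * Real.pi * Complex.I / q) * circleLoop r t := by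
      rw [circleLoop, circleLoop, mul_left_comm, ← Complex.exp_add]
      congr 2
      push_cast; ring
    rw [hrot, RotationChart.cornerV, RotationChart.cornerV, RotationChart.proj,
      RotationChart.proj, c.rotate_X _ _ (hr t), c.rotate_V _ _ (hr t)]
  obtain ⟨m, hm⟩ := hdvd
  have : ((q ^ 2 : ℕ) : ℤ) ∣ (n : ℤ) := ⟨m, by rw [← hqd', hm]; push_cast; ring⟩
  exact_mod_cast this

/-! ### The bundle over the maximal spectrum of the center -/

section CenterBundleFacts

variable {A : Type*} [CStarAlgebra A]

lemma sub_smul_one_mem_fiberIdeal (x : MaxCenter A) (z : cstarCenter A) :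
    (z : A) - x z • (1 : A) ∈ fiberIdeal x := by
  refine subset_closure (Ideal.subset_span ⟨z - algebraMap ℂ _ (x z), ?_, ?_⟩)
  · rw [map_sub, AlgHomClass.commutes, Algebra.algebraMap_self, RingHom.id_apply, sub_self]
  · rw [Algebra.algebraMap_eq_smul_one]; rfl

/-- In the fiber at `x`, a central element is the scalar `x z`. -/
lemma mk_center_eq (x : MaxCenter A) (z : cstarCenter A) :
    (Ideal.Quotient.mk (fiberIdeal x) (z : A)) = x z • (1 : CenterFiber x) := by
  have h := Ideal.Quotient.eq.2 (sub_smul_one_mem_fiberIdeal x z)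
  rw [h]
  rfl

lemma continuous_eval_center (z : cstarCenter A) : Continuous fun x : MaxCenter A => x z :=
  (WeakDual.eval_continuous z).comp continuous_subtype_val

/-- An element of the ideal at `x` is close to the ideals at all points near `x`. -/
lemma eventually_exists_mem_fiberIdeal (x : MaxCenter A) {i : A} (hi : i ∈ fiberIdeal x) {δ : ℝ}
    (hδ : 0 < δ) : ∀ᶠ y in 𝓝 x, ∃ j ∈ fiberIdeal y, ‖i - j‖ < δ := by
  have hspan : ∀ i ∈ Ideal.span {a : A | ∃ z : cstarCenter A, x z = 0 ∧ (z : A) = a},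
      ∀ δ > 0, ∀ᶠ y in 𝓝 x, ∃ j ∈ fiberIdeal y, ‖i - j‖ < δ := by
    intro i hi
    refine Submodule.span_induction (p := fun i _ => ∀ δ > 0, ∀ᶠ y in 𝓝 x,
      ∃ j ∈ fiberIdeal y, ‖i - j‖ < δ) ?_ ?_ ?_ ?_ hi
    · rintro _ ⟨z, hz, rfl⟩ δ hδ
      have hlim : Filter.Tendsto (fun y : MaxCenter A => ‖y z • (1 : A)‖) (𝓝 x) (𝓝 0) := by
        have hc : Continuous fun y : MaxCenter A => ‖y z • (1 : A)‖ :=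
          ((continuous_eval_center z).smul continuous_const).norm
        have := hc.tendsto x
        rwa [hz, zero_smul, norm_zero] at this
      filter_upwards [hlim.eventually_lt_const hδ] with y hy
      exact ⟨_, sub_smul_one_mem_fiberIdeal y z, by rwa [sub_sub_cancel]⟩
    · intro δ hδ
      exact Filter.Eventually.of_forall fun y => ⟨0, zero_mem _, by simpa using hδ⟩
    · intro u v _ _ hu hv δ hδ
      filter_upwards [hu (δ / 2) (half_pos hδ), hv (δ / 2) (half_pos hδ)] with y h1 h2
      obtain ⟨j, hj, hj'⟩ := h1
      obtain ⟨k, hk, hk'⟩ := h2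
      refine ⟨j + k, add_mem hj hk, ?_⟩
      rw [add_sub_add_comm]
      exact (norm_add_le _ _).trans_lt (by linarith)
    · intro r u _ hu δ hδ
      have hr : 0 < ‖r‖ + 1 := by positivity
      filter_upwards [hu (δ / (‖r‖ + 1)) (div_pos hδ hr)] with y h1
      obtain ⟨j, hj, hj'⟩ := h1
      refine ⟨r * j, Ideal.mul_mem_left _ _ hj, ?_⟩
      rw [smul_eq_mul, ← mul_sub]
      calc ‖r * (u - j)‖ ≤ ‖r‖ * ‖u - j‖ := norm_mul_le _ _
        _ ≤ (‖r‖ + 1) * ‖u - j‖ := by gcongr; linarith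
        _ < δ := by rwa [lt_div_iff₀' hr] at hj'
  obtain ⟨i', hi', hd⟩ := Metric.mem_closure_iff.1 (show i ∈ closure _ from hi) (δ / 2)
    (half_pos hδ)
  filter_upwards [hspan i' hi' (δ / 2) (half_pos hδ)] with y ⟨j, hj, hj'⟩
  refine ⟨j, hj, ?_⟩
  rw [dist_eq_norm] at hd
  calc ‖i - j‖ = ‖(i - i') + (i' - j)‖ := by rw [sub_add_sub_cancel]
    _ < δ := (norm_add_le _ _).trans_lt (by linarith)

/-- The norm of the value of a section is upper semicontinuous. -/
lemma isOpen_norm_mk_lt (a : A) (ε : ℝ) :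
    IsOpen {x : MaxCenter A | ‖Ideal.Quotient.mk (fiberIdeal x) a‖ < ε} := by
  refine isOpen_iff_mem_nhds.2 fun x hx => ?_
  obtain ⟨c, hc, hcε⟩ := Submodule.Quotient.norm_mk_lt (S := fiberIdeal x)
    (Ideal.Quotient.mk (fiberIdeal x) a) (sub_pos.2 hx)
  rw [add_sub_cancel] at hcε
  have hi : a - c ∈ fiberIdeal x := Ideal.Quotient.eq.1 hc.symm
  filter_upwards [eventually_exists_mem_fiberIdeal x hi (sub_pos.2 hcε)] with y ⟨j, hj, hj'⟩
  have h : Ideal.Quotient.mk (fiberIdeal y) a = Ideal.Quotient.mk (fiberIdeal y) (a - j) :=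
    Ideal.Quotient.eq.2 (by rwa [sub_sub_cancel])
  change ‖Ideal.Quotient.mk (fiberIdeal y) a‖ < ε
  rw [h]
  refine (Submodule.Quotient.norm_mk_le (fiberIdeal y) _).trans_lt ?_
  calc ‖a - j‖ = ‖(a - c - j) + c‖ := by congr 1; abel
    _ < ε := (norm_add_le _ _).trans_lt (by linarith)

/-- The section of the bundle given by an element of the algebra is continuous. -/
lemma continuous_centerSection (a : A) : Continuous (fun x : MaxCenter A =>
    (⟨x, Ideal.Quotient.mk (fiberIdeal x) a⟩ : FiberTotal (centerBundle A).Fiber)) := by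
  refine continuous_generateFrom_iff.2 ?_
  rintro _ ⟨c, U, ε, hU, -, rfl⟩
  have : ((fun x : MaxCenter A =>
      (⟨x, Ideal.Quotient.mk (fiberIdeal x) a⟩ : FiberTotal (centerBundle A).Fiber)) ⁻¹'
        centerTube c U ε) = U ∩ {x | ‖Ideal.Quotient.mk (fiberIdeal x) (a - c)‖ < ε} := by
    ext x
    simp only [Set.mem_inter_iff, Set.mem_ofPred_eq, map_sub]
    rfl
  rw [this]
  exact hU.inter (isOpen_norm_mk_lt _ _)

end CenterBundleFacts

/-! ### Homomorphisms from the function algebra of a quantum sphere -/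

section SphereHom

variable {m : ℕ} {θ : Matrix (Fin m) (Fin m) ℝ}

lemma isSphereFamily_sphereGen : IsSphereFamily θ (sphereGen θ) where
  normal i := ⟨Subtype.ext ((isSphereFamily_sphereProductGen θ).normal i).star_comm_self⟩
  comm i j := Subtype.ext ((isSphereFamily_sphereProductGen θ).comm i j)
  sum_eq_one := by
    have h := (isSphereFamily_sphereProductGen θ).sum_eq_one
    have e : ((∑ i, star (sphereGen θ i) * sphereGen θ i : SphereAlgebra θ) :
        sphereSubalgebra θ).1 = ∑ i, star (sphereProductGen θ i) * sphereProductGen θ i :=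
      map_sum (sphereSubalgebra θ).subtype _ _
    exact Subtype.ext (e.trans h)

/-- The homomorphism to the algebra of a realization. -/
def SphereRealization.hom (r : SphereRealization θ) : SphereAlgebra θ →⋆ₐ[ℂ] r.Alg where
  toFun a := ((show sphereSubalgebra θ from a).1 : ∀ r : SphereRealization θ, r.Alg) r
  map_one' := rfl
  map_mul' _ _ := rfl
  map_zero' := rfl
  map_add' _ _ := rfl
  commutes' _ := rfl
  map_star' _ := rfl

lemma sphereAlgebra_hom_ext {R : Type*} [CStarAlgebra R] {φ ψ : SphereAlgebra θ →⋆ₐ[ℂ] R}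
    (h : ∀ i, φ (sphereGen θ i) = ψ (sphereGen θ i)) : φ = ψ := by
  have hc : ∀ φ : SphereAlgebra θ →⋆ₐ[ℂ] R, Continuous φ := fun φ =>
    AddMonoidHomClass.continuous_of_bound φ 1 fun a => by
      rw [one_mul]; exact NonUnitalStarAlgHom.norm_apply_le φ a
  refine StarAlgHom.ext_topologicalClosure (R := ℂ)
    (S := StarAlgebra.adjoin ℂ (Set.range (sphereProductGen θ))) (hc φ) (hc ψ) ?_
  refine StarAlgHom.ext_adjoin ?_
  rintro ⟨_, hx⟩ ⟨i, rfl⟩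
  exact h i

/-- An element which commutes with the generators and their adjoints is central. -/
lemma mem_cstarCenter_of_commute {c : SphereAlgebra θ} (h : ∀ k, Commute c (sphereGen θ k))
    (h' : ∀ k, Commute c (star (sphereGen θ k))) : c ∈ cstarCenter (SphereAlgebra θ) := by
  refine (Subalgebra.mem_center_iff (R := ℂ)).2 fun a => ?_
  have hmem : (show sphereSubalgebra θ from c).1 ∈
      StarSubalgebra.centralizer ℂ (Set.range (sphereProductGen θ)) := by
    rw [StarSubalgebra.mem_centralizer_iff]
    rintro _ ⟨j, rfl⟩
    exact ⟨congrArg Subtype.val (h j).symm.eq, congrArg Subtype.val (h' j).symm.eq⟩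
  have ha : (show sphereSubalgebra θ from a).1 ∈ StarSubalgebra.centralizer ℂ
      (StarSubalgebra.centralizer ℂ (Set.range (sphereProductGen θ)) :
        Set (SphereProduct θ)) :=
    StarSubalgebra.topologicalClosure_adjoin_le_centralizer_centralizer ℂ _
      (show sphereSubalgebra θ from a).2
  rw [StarSubalgebra.mem_centralizer_iff] at ha
  exact Subtype.ext (ha _ hmem).1.symm

lemma sphereGen_pow_mem_center {q : ℕ}
    (hθ : ∀ i j, Complex.exp (2 * Real.pi * Complex.I * θ i j) ^ q = 1) (i : Fin m) :
    sphereGen θ i ^ q ∈ cstarCenter (SphereAlgebra θ) := by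
  have hF := isSphereFamily_sphereGen (θ := θ)
  have h : ∀ k, Commute (sphereGen θ i ^ q) (sphereGen θ k) := by
    intro k
    have h1 : SemiconjBy (sphereGen θ k) (sphereGen θ i)
        (Complex.exp (2 * Real.pi * Complex.I * θ i k) • sphereGen θ i) := by
      rw [SemiconjBy, smul_mul_assoc]
      exact hF.comm i k
    have h2 := h1.pow_right q
    rw [smul_pow, hθ, one_smul] at h2
    exact Commute.symm h2
  -- the generators are normal, so that Fuglede's theorem applies
  exact mem_cstarCenter_of_commute h fun k =>
    SemiconjBy.star_right (hF.normal k) (hF.normal k) (h k)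

end SphereHom

/-! ### Clock and shift matrices -/

section ClockShift

variable {q : ℕ}

/-- The clock matrix, with the diagonal entries `ζ ^ k`. -/
def clock (ζ : ℂ) : Matrix (ZMod q) (ZMod q) ℂ := Matrix.diagonal fun k => ζ ^ k.val

/-- The shift matrix: the permutation matrix of `k ↦ k + 1`. -/
def shift : Matrix (ZMod q) (ZMod q) ℂ := (Equiv.addRight (1 : ZMod q)).permMatrix ℂ

lemma shift_apply (k l : ZMod q) : (shift k l : ℂ) = if k + 1 = l then 1 else 0 := by
  simp [shift, Equiv.Perm.permMatrix, PEquiv.toMatrix_apply, Equiv.toPEquiv_apply, eq_comm]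

variable [NeZero q]

lemma pow_val_add_one {ζ : ℂ} (hζ : ζ ^ q = 1) (k : ZMod q) : ζ ^ (k + 1).val = ζ * ζ ^ k.val := by
  have h : ∀ a : ℕ, ζ ^ (a % q) = ζ ^ a := fun a => by
    conv_rhs => rw [← Nat.mod_add_div a q, pow_add, pow_mul, hζ, one_pow, mul_one]
  rw [ZMod.val_add, h, pow_add, mul_comm, ZMod.val_one_eq_one_mod, h, pow_one]

lemma shift_mul_clock {ζ : ℂ} (hζ : ζ ^ q = 1) :
    (shift * clock ζ : Matrix (ZMod q) (ZMod q) ℂ) = ζ • (clock ζ * shift) := by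
  ext k l
  rw [clock, Matrix.mul_diagonal, Matrix.smul_apply, Matrix.diagonal_mul, shift_apply]
  split_ifs with h
  · rw [← h, pow_val_add_one hζ]; simp
  · simp

lemma clock_mul_star {ζ : ℂ} (hζ : ‖ζ‖ = 1) :
    (clock ζ * star (clock ζ) : Matrix (ZMod q) (ZMod q) ℂ) = 1 := by
  rw [clock, Matrix.star_eq_conjTranspose, Matrix.diagonal_conjTranspose,
    Matrix.diagonal_mul_diagonal, ← Matrix.diagonal_one]
  congr 1
  funext k
  rw [Pi.star_apply, star_pow, ← mul_pow]
  have := Complex.mul_conj ζ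
  rw [Complex.normSq_eq_norm_sq, hζ] at this
  rw [show ζ * star ζ = 1 by simpa using this, one_pow]

lemma star_clock_mul {ζ : ℂ} (hζ : ‖ζ‖ = 1) :
    (star (clock ζ) * clock ζ : Matrix (ZMod q) (ZMod q) ℂ) = 1 :=
  mul_eq_one_comm.1 (clock_mul_star hζ)

lemma clock_pow {ζ : ℂ} (hζ : ζ ^ q = 1) : (clock ζ ^ q : Matrix (ZMod q) (ZMod q) ℂ) = 1 := by
  rw [clock, Matrix.diagonal_pow, ← Matrix.diagonal_one]
  congr 1
  funext k
  rw [Pi.pow_apply, ← pow_mul, mul_comm, pow_mul, hζ, one_pow]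

lemma shift_mul_star : (shift * star shift : Matrix (ZMod q) (ZMod q) ℂ) = 1 := by
  rw [shift, Matrix.star_eq_conjTranspose, Matrix.conjTranspose_permMatrix, ← Matrix.permMatrix_mul,
    inv_mul_cancel, Matrix.permMatrix_one]

lemma star_shift_mul : (star shift * shift : Matrix (ZMod q) (ZMod q) ℂ) = 1 :=
  mul_eq_one_comm.1 shift_mul_star

lemma shift_pow : (shift ^ q : Matrix (ZMod q) (ZMod q) ℂ) = 1 := by
  have h : ∀ (e : Equiv.Perm (ZMod q)) (j : ℕ),
      e.permMatrix ℂ ^ j = (e ^ j).permMatrix ℂ := fun e j => by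
    induction j with
    | zero => simp
    | succ j ih => rw [pow_succ, ih, pow_succ', Matrix.permMatrix_mul]
  have h1 : ∀ j : ℕ, (Equiv.addRight (1 : ZMod q)) ^ j = Equiv.addRight (j : ZMod q) := fun j => by
    induction j with
    | zero => ext x; simp
    | succ j ih => rw [pow_succ, ih]; ext x; simp [add_assoc, add_comm, add_left_comm]
  rw [shift, h, h1, ZMod.natCast_self]
  have : Equiv.addRight (0 : ZMod q) = 1 := by ext x; simp
  rw [this, Matrix.permMatrix_one]

/-- A matrix which commutes with a clock matrix of full order is diagonal. -/
lemma apply_eq_zero_of_commute_clock {ζ : ℂ} (hζ : IsPrimitiveRoot ζ q)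
    {M : Matrix (ZMod q) (ZMod q) ℂ} (h : M * clock ζ = clock ζ * M) {k l : ZMod q} (hkl : k ≠ l) :
    M k l = 0 := by
  have h1 := congrFun (congrFun h k) l
  rw [clock, Matrix.mul_diagonal, Matrix.diagonal_mul] at h1
  have h2 : M k l * (ζ ^ l.val - ζ ^ k.val) = 0 := by linear_combination h1
  refine (mul_eq_zero.1 h2).resolve_right fun h3 => hkl ?_
  exact (ZMod.val_injective q (hζ.pow_inj (ZMod.val_lt l) (ZMod.val_lt k) (sub_eq_zero.1 h3))).symm

end ClockShift

/-! ### The family of irreducible representations near a core circle -/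

/-- The modulus of the generator which is invertible near the core circle. -/
def longRadius (b : ℂ) : ℝ := √(1 + ‖b‖ ^ 2) / √(1 + 2 * ‖b‖ ^ 2)

/-- The factor by which the coordinate `b` is rescaled, so that all of `ℂ` parametrises the interior
of the meridian disc. -/
def transScale (b : ℂ) : ℝ := 1 / √(1 + 2 * ‖b‖ ^ 2)

/-- The coefficient of the generator which is invertible near the core circle. -/
def longCoeff (y : ℝ × ℂ) : ℂ := longRadius y.2 * Complex.exp (y.1 * Complex.I)

/-- The coefficient of the generator which vanishes on the core circle. -/
def transCoeff (y : ℝ × ℂ) : ℂ := transScale y.2 * y.2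

lemma continuous_transScale : Continuous transScale := by
  unfold transScale
  refine continuous_const.div (by fun_prop) fun b => ?_
  positivity

lemma continuous_longCoeff : Continuous longCoeff := by
  have h : Continuous longRadius := by
    unfold longRadius
    refine Continuous.div (by fun_prop) (by fun_prop) fun b => ?_
    positivity
  unfold longCoeff
  fun_prop

lemma continuous_transCoeff : Continuous transCoeff := by
  have := continuous_transScale
  unfold transCoeff
  fun_prop

lemma transScale_pos (b : ℂ) : 0 < transScale b := by unfold transScale; positivity

lemma norm_longCoeff_sq (y : ℝ × ℂ) :
    ‖longCoeff y‖ ^ 2 = (1 + ‖y.2‖ ^ 2) / (1 + 2 * ‖y.2‖ ^ 2) := by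
  rw [longCoeff, norm_mul, Complex.norm_exp_ofReal_mul_I, mul_one, Complex.norm_real,
    Real.norm_eq_abs, sq_abs, longRadius, div_pow, Real.sq_sqrt (by positivity),
    Real.sq_sqrt (by positivity)]

lemma norm_transCoeff (y : ℝ × ℂ) : ‖transCoeff y‖ = transScale y.2 * ‖y.2‖ := by
  rw [transCoeff, norm_mul, Complex.norm_real, Real.norm_of_nonneg (transScale_pos _).le]

lemma norm_transCoeff_sq (y : ℝ × ℂ) :
    ‖transCoeff y‖ ^ 2 = ‖y.2‖ ^ 2 / (1 + 2 * ‖y.2‖ ^ 2) := by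
  rw [norm_transCoeff, mul_pow, transScale, div_pow, Real.sq_sqrt (by positivity), one_pow,
    one_div_mul_eq_div]

lemma norm_sq_add_norm_sq (y : ℝ × ℂ) : ‖longCoeff y‖ ^ 2 + ‖transCoeff y‖ ^ 2 = 1 := by
  rw [norm_longCoeff_sq, norm_transCoeff_sq]
  field_simp
  ring

lemma norm_transCoeff_sq_le (y : ℝ × ℂ) : ‖transCoeff y‖ ^ 2 ≤ ‖longCoeff y‖ ^ 2 := by
  rw [norm_longCoeff_sq, norm_transCoeff_sq]
  gcongr
  linarith

lemma longCoeff_ne_zero (y : ℝ × ℂ) : longCoeff y ≠ 0 := by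
  have h := norm_longCoeff_sq y
  rw [← norm_ne_zero_iff]
  intro h0
  rw [h0] at h
  have : 0 < (1 + ‖y.2‖ ^ 2) / (1 + 2 * ‖y.2‖ ^ 2) := by positivity
  rw [← h] at this
  simp at this

/-- A shift of the angle by `σ` divides the coefficient by `ω`. -/
lemma longCoeff_shift {σ : ℝ} {ω : ℂ} (hσ : Complex.exp (σ * Complex.I) * ω = 1) (s : ℝ) (b : ℂ) :
    longCoeff (s + σ, b) * ω = longCoeff (s, b) := by
  simp only [longCoeff, Complex.ofReal_add, add_mul, Complex.exp_add]
  linear_combination (longRadius b * Complex.exp (s * Complex.I)) * hσ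

lemma exp_shift_mul {ω : ℂ} {t : ℝ} (hω : ω = Complex.exp (2 * Real.pi * Complex.I * t)) :
    Complex.exp (((-(2 * Real.pi * t) : ℝ) : ℂ) * Complex.I) * ω = 1 := by
  rw [hω, ← Complex.exp_add, Complex.exp_eq_one_iff]
  exact ⟨0, by push_cast; ring⟩

section Realization

open scoped Matrix.Norms.L2Operator BoundedContinuousFunction

variable {q : ℕ} [NeZero q]

/-- The bounded matrix-valued function `y ↦ f y • M`. -/
def smulMatrixBCF (f : ℝ × ℂ → ℂ) (hf : Continuous f) (h1 : ∀ y, ‖f y‖ ^ 2 ≤ 1)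
    (M : Matrix (ZMod q) (ZMod q) ℂ) : (ℝ × ℂ) →ᵇ Matrix (ZMod q) (ZMod q) ℂ :=
  BoundedContinuousFunction.ofNormedAddCommGroup (fun y => f y • M) (hf.smul continuous_const) ‖M‖
    fun y => by
      rw [norm_smul]
      have : ‖f y‖ ≤ 1 := by
        have := h1 y
        nlinarith [norm_nonneg (f y)]
      exact mul_le_of_le_one_left (norm_nonneg _) this

/-- The generators of the quantum 3-sphere in the family of representations given by clock and shift
matrices. The generator with index `i` is the invertible one. -/
def clockShiftGen (ω : ℂ) (i k : Fin 2) : (ℝ × ℂ) →ᵇ Matrix (ZMod q) (ZMod q) ℂ :=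
  if k = i then
    smulMatrixBCF longCoeff continuous_longCoeff
      (fun y => by have := norm_sq_add_norm_sq y; nlinarith [sq_nonneg ‖transCoeff y‖]) (clock ω)
  else
    smulMatrixBCF transCoeff continuous_transCoeff
      (fun y => by have := norm_sq_add_norm_sq y; nlinarith [sq_nonneg ‖longCoeff y‖]) shift

lemma clockShiftGen_self (ω : ℂ) (i : Fin 2) (y : ℝ × ℂ) :
    clockShiftGen (q := q) ω i i y = longCoeff y • clock ω := by
  rw [clockShiftGen, if_pos rfl]; rfl

lemma clockShiftGen_ne (ω : ℂ) {i j : Fin 2} (h : j ≠ i) (y : ℝ × ℂ) :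
    clockShiftGen (q := q) ω i j y = transCoeff y • shift := by
  rw [clockShiftGen, if_neg h]; rfl

lemma star_smul_mul_smul (c : ℂ) {M : Matrix (ZMod q) (ZMod q) ℂ} (hM : star M * M = 1) :
    star (c • M) * (c • M) = ((‖c‖ ^ 2 : ℝ) : ℂ) • (1 : Matrix (ZMod q) (ZMod q) ℂ) := by
  rw [star_smul, smul_mul_smul_comm, hM, Complex.star_def, mul_comm, Complex.mul_conj,
    Complex.normSq_eq_norm_sq]

lemma isStarNormal_smul (c : ℂ) {M : Matrix (ZMod q) (ZMod q) ℂ} (hM : star M * M = 1) :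
    star (c • M) * (c • M) = (c • M) * star (c • M) := by
  rw [star_smul, smul_mul_smul_comm, smul_mul_smul_comm, hM, mul_eq_one_comm.1 hM, mul_comm]

lemma sum_fin_two_of_ne {M : Type*} [AddCommMonoid M] {i j : Fin 2} (h : j ≠ i) (f : Fin 2 → M) :
    ∑ k, f k = f i + f j := by
  rw [Fin.sum_univ_two]
  fin_cases i <;> fin_cases j <;> first | exact absurd rfl h | rfl | exact add_comm _ _

lemma isSphereFamily_clockShiftGen {θ : Matrix (Fin 2) (Fin 2) ℝ} (hskew : θ.transpose = -θ)
    {i j : Fin 2} (hij : j ≠ i) {ω : ℂ} (hω : ω = Complex.exp (2 * Real.pi * Complex.I * θ i j))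
    (hωq : ω ^ q = 1) : IsSphereFamily θ (clockShiftGen (q := q) ω i) := by
  have hω1 : ‖ω‖ = 1 := Complex.norm_eq_one_of_pow_eq_one hωq (NeZero.ne q)
  have hsk : ∀ k l, θ l k = -θ k l := fun k l => congrFun (congrFun hskew k) l
  have hdiag : ∀ k, θ k k = 0 := fun k => by have := hsk k k; linarith
  have hcases : ∀ k, k = i ∨ k = j := fun k => by omega
  have hrel : shift * clock ω = ω • (clock ω * shift : Matrix (ZMod q) (ZMod q) ℂ) :=
    shift_mul_clock hωq
  refine ⟨fun k => ⟨?_⟩, fun k l => ?_, ?_⟩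
  · refine BoundedContinuousFunction.ext fun y => ?_
    change star (clockShiftGen (q := q) ω i k y) * clockShiftGen (q := q) ω i k y =
      clockShiftGen (q := q) ω i k y * star (clockShiftGen (q := q) ω i k y)
    rcases hcases k with rfl | rfl
    · rw [clockShiftGen_self]; exact isStarNormal_smul _ (star_clock_mul hω1)
    · rw [clockShiftGen_ne _ hij]; exact isStarNormal_smul _ star_shift_mul
  · refine BoundedContinuousFunction.ext fun y => ?_
    change clockShiftGen (q := q) ω i l y * clockShiftGen (q := q) ω i k y =
      Complex.exp (2 * Real.pi * Complex.I * θ k l) •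
        (clockShiftGen (q := q) ω i k y * clockShiftGen (q := q) ω i l y)
    rcases eq_or_ne k l with rfl | hkl
    · simp [hdiag]
    rcases hcases k with hk | hk <;> rcases hcases l with hl | hl
    · exact absurd (hk.trans hl.symm) hkl
    · subst hk hl
      rw [clockShiftGen_self, clockShiftGen_ne _ hij, ← hω, smul_mul_smul_comm, smul_mul_smul_comm,
        hrel, smul_smul, smul_smul]
      congr 1; ring
    · subst hk hl
      rw [clockShiftGen_self, clockShiftGen_ne _ hij, hsk, smul_mul_smul_comm, smul_mul_smul_comm,
        hrel, Complex.ofReal_neg, mul_neg, Complex.exp_neg, ← hω, smul_smul, smul_smul]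
      have : ω ≠ 0 := by rintro rfl; simp at hω1
      congr 1; field_simp
    · exact absurd (hk.trans hl.symm) hkl
  · rw [sum_fin_two_of_ne hij]
    refine BoundedContinuousFunction.ext fun y => ?_
    change star (clockShiftGen (q := q) ω i i y) * clockShiftGen (q := q) ω i i y +
      star (clockShiftGen (q := q) ω i j y) * clockShiftGen (q := q) ω i j y = 1
    rw [clockShiftGen_self, clockShiftGen_ne _ hij, star_smul_mul_smul _ (star_clock_mul hω1),
      star_smul_mul_smul _ star_shift_mul, ← add_smul, ← Complex.ofReal_add, norm_sq_add_norm_sq,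
      Complex.ofReal_one, one_smul]

end Realization

section CorePoint

open scoped Matrix.Norms.L2Operator BoundedContinuousFunction

variable {q : ℕ} [NeZero q] {θ : Matrix (Fin 2) (Fin 2) ℝ} {i j : Fin 2} {ω : ℂ}

/-- The realization of the quantum 3-sphere by clock and shift matrices. -/
def clockShiftRealization (hF : IsSphereFamily θ (clockShiftGen (q := q) ω i)) :
    SphereRealization θ where
  Alg := (ℝ × ℂ) →ᵇ Matrix (ZMod q) (ZMod q) ℂ
  nontrivial := ⟨0, 1, fun h => zero_ne_one (α := Matrix (ZMod q) (ZMod q) ℂ)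
    (DFunLike.congr_fun h (0, 0))⟩
  T := clockShiftGen ω i
  isSphereFamily := hF

/-- The family of all clock and shift representations, as one homomorphism. -/
def clockShiftHom (hF : IsSphereFamily θ (clockShiftGen (q := q) ω i)) :
    SphereAlgebra θ →⋆ₐ[ℂ] ((ℝ × ℂ) →ᵇ Matrix (ZMod q) (ZMod q) ℂ) :=
  (clockShiftRealization hF).hom

/-- The representation of the quantum 3-sphere by clock and shift matrices with parameter `y`. -/
def clockShiftRep (hF : IsSphereFamily θ (clockShiftGen (q := q) ω i)) (y : ℝ × ℂ) :
    SphereAlgebra θ →⋆ₐ[ℂ] Matrix (ZMod q) (ZMod q) ℂ where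
  toFun z := clockShiftHom hF z y
  map_one' := by rw [map_one]; rfl
  map_mul' a b := by rw [map_mul]; rfl
  map_zero' := by rw [map_zero]; rfl
  map_add' a b := by rw [map_add]; rfl
  commutes' c := by rw [AlgHomClass.commutes]; rfl
  map_star' a := by rw [map_star]; rfl

variable (hF : IsSphereFamily θ (clockShiftGen (q := q) ω i))

lemma clockShiftRep_self (y : ℝ × ℂ) :
    clockShiftRep hF y (sphereGen θ i) = longCoeff y • clock ω := clockShiftGen_self ω i y

lemma clockShiftRep_ne (hij : j ≠ i) (y : ℝ × ℂ) :
    clockShiftRep hF y (sphereGen θ j) = transCoeff y • shift := clockShiftGen_ne ω hij y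

lemma continuous_clockShiftRep (z : SphereAlgebra θ) :
    Continuous fun y => clockShiftRep hF y z :=
  (clockShiftHom hF z).continuous

lemma clockShiftRep_center_comm (y : ℝ × ℂ) (z : cstarCenter (SphereAlgebra θ))
    (a : SphereAlgebra θ) : clockShiftRep hF y z * clockShiftRep hF y a =
      clockShiftRep hF y a * clockShiftRep hF y z := by
  rw [← map_mul, ← map_mul, cstarCenter_mul_comm]

lemma clockShiftRep_center_diag (hω : IsPrimitiveRoot ω q) (y : ℝ × ℂ)
    (z : cstarCenter (SphereAlgebra θ)) {k l : ZMod q} (hkl : k ≠ l) :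
    clockShiftRep hF y z k l = 0 := by
  refine apply_eq_zero_of_commute_clock hω ?_ hkl
  have h := clockShiftRep_center_comm hF y z (sphereGen θ i)
  rw [clockShiftRep_self, mul_smul_comm, smul_mul_assoc] at h
  exact smul_right_injective _ (longCoeff_ne_zero y) h

instance : CompleteSpace (cstarCenter (SphereAlgebra θ)) := by
  have h : IsClosed ((cstarCenter (SphereAlgebra θ) : StarSubalgebra ℂ (SphereAlgebra θ)) :
      Set (SphereAlgebra θ)) := by
    have e : ((cstarCenter (SphereAlgebra θ) : StarSubalgebra ℂ (SphereAlgebra θ)) :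
        Set (SphereAlgebra θ)) = Set.centralizer Set.univ :=
      (Set.centralizer_univ (M := SphereAlgebra θ)).symm
    rw [e]
    exact Set.isClosed_centralizer _
  exact h.completeSpace_coe

/-- The point of the maximal spectrum of the center which corresponds to the representation with
parameter `y`: the central character of that representation, read off from a diagonal entry. -/
def centralPoint (hω : IsPrimitiveRoot ω q) (y : ℝ × ℂ) : MaxCenter (SphereAlgebra θ) :=
  WeakDual.CharacterSpace.equivAlgHom.symm
    { toFun := fun z => clockShiftRep hF y z 0 0
      map_one' := by
        change clockShiftRep hF y 1 0 0 = 1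
        rw [map_one, Matrix.one_apply_eq]
      map_mul' := fun z w => by
        change clockShiftRep hF y (z * w) 0 0 = _
        rw [map_mul, Matrix.mul_apply, Finset.sum_eq_single 0]
        · intro k _ hk
          rw [clockShiftRep_center_diag hF hω y z hk.symm, zero_mul]
        · simp
      map_zero' := by
        change clockShiftRep hF y 0 0 0 = 0
        rw [map_zero, Matrix.zero_apply]
      map_add' := fun z w => by
        change clockShiftRep hF y (z + w) 0 0 = _
        rw [map_add, Matrix.add_apply]
      commutes' := fun c => by
        change clockShiftRep hF y (algebraMap ℂ _ c) 0 0 = _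
        rw [AlgHomClass.commutes, Matrix.algebraMap_matrix_apply, if_pos rfl] }

variable (hω : IsPrimitiveRoot ω q)

lemma centralPoint_apply (y : ℝ × ℂ) (z : cstarCenter (SphereAlgebra θ)) :
    centralPoint hF hω y z = clockShiftRep hF y z 0 0 := rfl

lemma continuous_centralPoint : Continuous (centralPoint hF hω) := by
  refine Continuous.subtype_mk (WeakDual.continuous_of_continuous_eval fun z => ?_) _
  exact (continuous_clockShiftRep hF z).matrix_elem 0 0

/-- Rescaling the parameter by `ζ` with `ζ ^ q = 1` conjugates the representation by a clock
matrix. -/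
lemma centralPoint_rotate (hij : j ≠ i) {ζ : ℂ} (hζ : ζ ^ q = 1) (s : ℝ) (b : ℂ) :
    centralPoint hF hω (s, ζ * b) = centralPoint hF hω (s, b) := by
  have hζ1 : ‖ζ‖ = 1 := Complex.norm_eq_one_of_pow_eq_one hζ (NeZero.ne q)
  have hnorm : ‖ζ * b‖ = ‖b‖ := by rw [norm_mul, hζ1, one_mul]
  let D : unitary (Matrix (ZMod q) (ZMod q) ℂ) :=
    ⟨clock ζ, Unitary.mem_iff.2 ⟨star_clock_mul hζ1, clock_mul_star hζ1⟩⟩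
  have hcases : ∀ k, k = i ∨ k = j := fun k => by omega
  have hhom : (((Unitary.conjStarAlgAut ℂ _ D : Matrix (ZMod q) (ZMod q) ℂ ≃⋆ₐ[ℂ] _) :
      Matrix (ZMod q) (ZMod q) ℂ →⋆ₐ[ℂ] Matrix (ZMod q) (ZMod q) ℂ)).comp
        (clockShiftRep hF (s, ζ * b)) = clockShiftRep hF (s, b) := by
    refine sphereAlgebra_hom_ext fun k => ?_
    change clock ζ * clockShiftRep hF (s, ζ * b) (sphereGen θ k) * star (clock ζ) = _
    rcases hcases k with rfl | rfl
    · have hcl : clock ζ * clock ω = (clock ω * clock ζ : Matrix (ZMod q) (ZMod q) ℂ) := by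
        simp only [clock, Matrix.diagonal_mul_diagonal, mul_comm]
      rw [clockShiftRep_self, clockShiftRep_self, mul_smul_comm, smul_mul_assoc, hcl, mul_assoc,
        clock_mul_star hζ1, mul_one]
      simp only [longCoeff, longRadius, hnorm]
    · have e : transCoeff (s, ζ * b) = ζ * transCoeff (s, b) := by
        simp only [transCoeff, transScale, hnorm]; ring
      rw [clockShiftRep_ne hF hij, clockShiftRep_ne hF hij, e, mul_comm ζ, mul_smul, mul_smul_comm,
        mul_smul_comm, ← shift_mul_clock hζ, smul_mul_assoc, mul_assoc, clock_mul_star hζ1, mul_one]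
  have h0 : ∀ M : Matrix (ZMod q) (ZMod q) ℂ,
      (clock ζ * M * star (clock ζ) : Matrix (ZMod q) (ZMod q) ℂ) 0 0 = M 0 0 := by
    intro M
    rw [clock, Matrix.star_eq_conjTranspose, Matrix.diagonal_conjTranspose, Matrix.mul_diagonal,
      Matrix.diagonal_mul]
    simp
  refine Subtype.ext (DFunLike.ext _ _ fun z => ?_)
  change clockShiftRep hF (s, ζ * b) z 0 0 = clockShiftRep hF (s, b) z 0 0
  rw [← hhom]
  exact (h0 _).symm

/-- Shifting the angle so that `longCoeff` is divided by `ω` conjugates the representation by the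
shift matrix. -/
lemma centralPoint_shift (hij : j ≠ i) {σ : ℝ} (hσ : Complex.exp (σ * Complex.I) * ω = 1)
    (s : ℝ) (b : ℂ) : centralPoint hF hω (s + σ, b) = centralPoint hF hω (s, b) := by
  let S : unitary (Matrix (ZMod q) (ZMod q) ℂ) :=
    ⟨shift, Unitary.mem_iff.2 ⟨star_shift_mul, shift_mul_star⟩⟩
  have hcases : ∀ k, k = i ∨ k = j := fun k => by omega
  have hhom : ∀ b, (((Unitary.conjStarAlgAut ℂ _ S : Matrix (ZMod q) (ZMod q) ℂ ≃⋆ₐ[ℂ] _) :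
      Matrix (ZMod q) (ZMod q) ℂ →⋆ₐ[ℂ] Matrix (ZMod q) (ZMod q) ℂ)).comp
        (clockShiftRep hF (s + σ, b)) = clockShiftRep hF (s, b) := by
    intro b
    refine sphereAlgebra_hom_ext fun k => ?_
    change shift * clockShiftRep hF (s + σ, b) (sphereGen θ k) * star shift = _
    rcases hcases k with rfl | rfl
    · rw [clockShiftRep_self, clockShiftRep_self, mul_smul_comm, shift_mul_clock hω.pow_eq_one,
        smul_smul, longCoeff_shift hσ, smul_mul_assoc, mul_assoc, shift_mul_star, mul_one]
    · rw [clockShiftRep_ne hF hij, clockShiftRep_ne hF hij, mul_smul_comm, smul_mul_assoc,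
        mul_assoc, shift_mul_star, mul_one]
      rfl
  refine Subtype.ext (DFunLike.ext _ _ fun z => ?_)
  change clockShiftRep hF (s + σ, b) z 0 0 = clockShiftRep hF (s, b) z 0 0
  -- away from the core circle the representation is irreducible; the rest follows by continuity
  have hcont : ∀ s, Continuous fun b : ℂ => clockShiftRep hF (s, b) z 0 0 := fun s =>
    (continuous_clockShiftRep hF (z : SphereAlgebra θ)).matrix_elem 0 0 |>.comp
      (Continuous.prodMk_right s)
  refine congrFun (Continuous.ext_on (dense_compl_singleton (0 : ℂ)) (hcont (s + σ)) (hcont s)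
    fun b hb => ?_) b
  have hb' : transCoeff (s + σ, b) ≠ 0 :=
    mul_ne_zero (Complex.ofReal_ne_zero.2 (transScale_pos b).ne') hb
  have hcomm : clockShiftRep hF (s + σ, b) z * shift = shift * clockShiftRep hF (s + σ, b) z := by
    have h := clockShiftRep_center_comm hF (s + σ, b) z (sphereGen θ j)
    rw [clockShiftRep_ne hF hij, mul_smul_comm, smul_mul_assoc] at h
    exact smul_right_injective _ hb' h
  have h1 : clockShiftRep hF (s, b) z =
      shift * clockShiftRep hF (s + σ, b) z * star shift := by
    rw [← hhom b]; rfl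
  change clockShiftRep hF (s + σ, b) z 0 0 = clockShiftRep hF (s, b) z 0 0
  rw [h1, ← hcomm, mul_assoc, shift_mul_star, mul_one]

lemma centralPoint_sphereRadius_self (y : ℝ × ℂ) :
    centralPoint hF hω y (sphereRadius θ i) = ((‖longCoeff y‖ ^ 2 : ℝ) : ℂ) := by
  have hω1 : ‖ω‖ = 1 := hω.norm'_eq_one (NeZero.ne q)
  rw [centralPoint_apply]
  change clockShiftRep hF y (star (sphereGen θ i) * sphereGen θ i) 0 0 = _
  rw [map_mul, map_star, clockShiftRep_self, star_smul_mul_smul _ (star_clock_mul hω1)]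
  simp

lemma centralPoint_sphereRadius_ne (hij : j ≠ i) (y : ℝ × ℂ) :
    centralPoint hF hω y (sphereRadius θ j) = ((‖transCoeff y‖ ^ 2 : ℝ) : ℂ) := by
  rw [centralPoint_apply]
  change clockShiftRep hF y (star (sphereGen θ j) * sphereGen θ j) 0 0 = _
  rw [map_mul, map_star, clockShiftRep_ne hF hij, star_smul_mul_smul _ star_shift_mul]
  simp

lemma centralPoint_mem (hij : j ≠ i) (y : ℝ × ℂ) :
    centralPoint hF hω y ∈ heegaardSolidTorus θ i := by
  intro k
  have hcases : k = i ∨ k = j := by omega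
  rw [centralPoint_sphereRadius_self]
  rcases hcases with rfl | rfl
  · rw [centralPoint_sphereRadius_self]
  · rw [centralPoint_sphereRadius_ne hF hω hij, Complex.ofReal_re, Complex.ofReal_re]
    exact norm_transCoeff_sq_le y

/-- The `q`-th powers of the generators are central, hence scalars in each fiber. -/
lemma mk_sphereGen_self_pow
    (hθ : ∀ i j, Complex.exp (2 * Real.pi * Complex.I * θ i j) ^ q = 1) (y : ℝ × ℂ) :
    (Ideal.Quotient.mk (fiberIdeal (centralPoint hF hω y)) (sphereGen θ i)) ^ q =
      longCoeff y ^ q • (1 : CenterFiber (centralPoint hF hω y)) := by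
  rw [← map_pow]
  refine (mk_center_eq (centralPoint hF hω y) ⟨_, sphereGen_pow_mem_center hθ i⟩).trans ?_
  rw [centralPoint_apply]
  change clockShiftRep hF y (sphereGen θ i ^ q) 0 0 • _ = _
  rw [map_pow, clockShiftRep_self, smul_pow, clock_pow hω.pow_eq_one, Matrix.smul_apply,
    Matrix.one_apply_eq, smul_eq_mul, mul_one]

lemma mk_sphereGen_ne_pow (hij : j ≠ i)
    (hθ : ∀ i j, Complex.exp (2 * Real.pi * Complex.I * θ i j) ^ q = 1) (y : ℝ × ℂ) :
    (Ideal.Quotient.mk (fiberIdeal (centralPoint hF hω y)) (sphereGen θ j)) ^ q =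
      transCoeff y ^ q • (1 : CenterFiber (centralPoint hF hω y)) := by
  rw [← map_pow]
  refine (mk_center_eq (centralPoint hF hω y) ⟨_, sphereGen_pow_mem_center hθ j⟩).trans ?_
  rw [centralPoint_apply]
  change clockShiftRep hF y (sphereGen θ j ^ q) 0 0 • _ = _
  rw [map_pow, clockShiftRep_ne hF hij, smul_pow, shift_pow, Matrix.smul_apply,
    Matrix.one_apply_eq, smul_eq_mul, mul_one]

lemma star_mk_mul_mk_sphereGen_ne (hij : j ≠ i) (y : ℝ × ℂ) :
    star (Ideal.Quotient.mk (fiberIdeal (centralPoint hF hω y)) (sphereGen θ j)) *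
      Ideal.Quotient.mk (fiberIdeal (centralPoint hF hω y)) (sphereGen θ j) =
      ((‖transCoeff y‖ ^ 2 : ℝ) : ℂ) • (1 : CenterFiber (centralPoint hF hω y)) := by
  have h := mk_center_eq (centralPoint hF hω y) (sphereRadius θ j)
  rw [centralPoint_sphereRadius_ne hF hω hij] at h
  exact h

end CorePoint

/-! ### Local trivializations -/

section Trivialization

variable {K : Type*} [TopologicalSpace K] {B : StarAlgebraBundle K} {n : ℕ}

/-- The map of total spaces which belongs to fiberwise isomorphisms with the matrix algebra over a
subset `U` of the base. -/
def trivMap {U : Set K} (φ : ∀ y : U, B.Fiber y ≃⋆ₐ[ℂ] Matrix (Fin n) (Fin n) ℂ)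
    (s : {s : FiberTotal B.Fiber // s.base ∈ U}) : U × Matrix (Fin n) (Fin n) ℂ :=
  (⟨s.1.base, s.2⟩, φ ⟨s.1.base, s.2⟩ s.1.val)

open Classical in
/-- A section of the bundle, written as a matrix in a trivialization over `U` (and zero outside
`U`). -/
def trivSection {U : Set K} (φ : ∀ y : U, B.Fiber y ≃⋆ₐ[ℂ] Matrix (Fin n) (Fin n) ℂ)
    (τ : ∀ x, B.Fiber x) (x : K) : Matrix (Fin n) (Fin n) ℂ :=
  if h : x ∈ U then φ ⟨x, h⟩ (τ x) else 0

variable {U U' : Set K} {φ : ∀ y : U, B.Fiber y ≃⋆ₐ[ℂ] Matrix (Fin n) (Fin n) ℂ}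
  {φ' : ∀ y : U', B.Fiber y ≃⋆ₐ[ℂ] Matrix (Fin n) (Fin n) ℂ}

lemma trivSection_of_mem (τ : ∀ x, B.Fiber x) {x : K} (h : x ∈ U) :
    trivSection φ τ x = φ ⟨x, h⟩ (τ x) := dif_pos h

lemma continuousOn_trivSection (hφ : IsHomeomorph (trivMap φ)) {τ : ∀ x, B.Fiber x}
    (hτ : Continuous fun x => (⟨x, τ x⟩ : FiberTotal B.Fiber)) :
    ContinuousOn (trivSection φ τ) U := by
  rw [continuousOn_iff_continuous_domRestrict]
  have h : Continuous fun x : U => (trivMap φ ⟨⟨x, τ x⟩, x.2⟩).2 :=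
    continuous_snd.comp (hφ.continuous.comp
      ((hτ.comp continuous_subtype_val).subtype_mk fun x : U => x.2))
  refine h.congr fun x => ?_
  rw [Set.domRestrict_apply, trivSection_of_mem τ x.2]
  rfl

open Classical in
/-- The change of trivialization (and the identity outside the common domain). -/
def trivChange (φ : ∀ y : U, B.Fiber y ≃⋆ₐ[ℂ] Matrix (Fin n) (Fin n) ℂ)
    (φ' : ∀ y : U', B.Fiber y ≃⋆ₐ[ℂ] Matrix (Fin n) (Fin n) ℂ) (x : K) :
    Matrix (Fin n) (Fin n) ℂ ≃ₐ[ℂ] Matrix (Fin n) (Fin n) ℂ :=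
  if h : x ∈ U ∩ U' then
    ((φ' ⟨x, h.2⟩).symm.trans (φ ⟨x, h.1⟩)).toAlgEquiv
  else AlgEquiv.refl

lemma trivChange_apply {x : K} (h : x ∈ U ∩ U') (G : Matrix (Fin n) (Fin n) ℂ) :
    trivChange φ φ' x G = φ ⟨x, h.1⟩ ((φ' ⟨x, h.2⟩).symm G) := by
  rw [trivChange, dif_pos h]; rfl

lemma trivChange_trivSection (τ : ∀ x, B.Fiber x) {x : K} (h : x ∈ U ∩ U') :
    trivChange φ φ' x (trivSection φ' τ x) = trivSection φ τ x := by
  rw [trivChange_apply h, trivSection_of_mem τ h.1, trivSection_of_mem τ h.2,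
    StarAlgEquiv.symm_apply_apply]

lemma continuousOn_trivChange (hφ : IsHomeomorph (trivMap φ)) (hφ' : IsHomeomorph (trivMap φ'))
    (G : Matrix (Fin n) (Fin n) ℂ) :
    ContinuousOn (fun x => trivChange φ φ' x G) (U ∩ U') := by
  rw [continuousOn_iff_continuous_domRestrict]
  -- the section over `U'` which is constantly `G` in the second trivialization
  let e := hφ'.homeomorph (trivMap φ')
  have hinv : ∀ x : U', e.symm (x, G) = ⟨⟨x, (φ' x).symm G⟩, x.2⟩ := fun x => by
    rw [Homeomorph.symm_apply_eq]
    refine Prod.ext rfl ?_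
    exact ((φ' x).apply_symm_apply G).symm
  have hc : Continuous fun x : U' => (⟨x, (φ' x).symm G⟩ : FiberTotal B.Fiber) := by
    have h1 : Continuous fun x : U' => (e.symm (x, G)).1 :=
      continuous_subtype_val.comp (e.symm.continuous.comp (by fun_prop))
    exact h1.congr fun x => by rw [hinv]
  have hc2 : Continuous fun x : (U ∩ U' : Set K) =>
      (⟨x, (φ' ⟨x, x.2.2⟩).symm G⟩ : FiberTotal B.Fiber) :=
    hc.comp (continuous_subtype_val.subtype_mk fun x : (U ∩ U' : Set K) => x.2.2)
  have h : Continuous fun x : (U ∩ U' : Set K) =>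
      (trivMap φ ⟨⟨x, (φ' ⟨x, x.2.2⟩).symm G⟩, x.2.1⟩).2 :=
    continuous_snd.comp (hφ.continuous.comp (hc2.subtype_mk fun x => x.2.1))
  refine h.congr fun x => ?_
  rw [Set.domRestrict_apply, trivChange_apply x.2]
  rfl

end Trivialization

section SphereCharts

open scoped Matrix.Norms.L2Operator BoundedContinuousFunction

variable {q : ℕ} [NeZero q] {θ : Matrix (Fin 2) (Fin 2) ℝ} {i j : Fin 2} {ω : ℂ} {n : ℕ}
  {B : StarAlgebraBundle.{1, v} (heegaardSolidTorus θ i)}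

/-- The homomorphism from the fiber of the bundle of the quantum sphere given by an embedding. -/
def embeddingHom (e : StarAlgebraBundle.Embedding
    ((sphereBundle θ).restrict (heegaardSolidTorus θ i)) B) (x : heegaardSolidTorus θ i) :
    CenterFiber (x : MaxCenter (SphereAlgebra θ)) →⋆ₐ[ℂ] B.Fiber x := e.toFun x

/-- The section of `B` which is the image of a generator. -/
def genSection (e : StarAlgebraBundle.Embedding
    ((sphereBundle θ).restrict (heegaardSolidTorus θ i)) B) (k : Fin 2)
    (x : heegaardSolidTorus θ i) : B.Fiber x :=
  embeddingHom e x (Ideal.Quotient.mk (fiberIdeal (x : MaxCenter (SphereAlgebra θ)))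
    (sphereGen θ k))

lemma continuous_genSection (e : StarAlgebraBundle.Embedding
    ((sphereBundle θ).restrict (heegaardSolidTorus θ i)) B) (k : Fin 2) :
    Continuous fun x => (⟨x, genSection e k x⟩ : FiberTotal B.Fiber) := by
  have h : Continuous fun x : heegaardSolidTorus θ i =>
      (⟨x, Ideal.Quotient.mk (fiberIdeal (x : MaxCenter (SphereAlgebra θ))) (sphereGen θ k)⟩ :
        FiberTotal ((sphereBundle θ).restrict (heegaardSolidTorus θ i)).Fiber) :=
    continuous_induced_rng.2
      ((continuous_centerSection (sphereGen θ k)).comp continuous_subtype_val)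
  exact e.continuous.comp h

/-- In a trivialization, the images of the generators satisfy the relations of the fiber. The point
`c` is a separate variable so that it can be given in another form. -/
lemma exists_trivSection_genSection {U : Set (heegaardSolidTorus θ i)}
    (φ : ∀ y : U, B.Fiber y ≃⋆ₐ[ℂ] Matrix (Fin n) (Fin n) ℂ)
    (e : StarAlgebraBundle.Embedding
      ((sphereBundle θ).restrict (heegaardSolidTorus θ i)) B) {x : heegaardSolidTorus θ i}
    (hx : x ∈ U) {c : MaxCenter (SphereAlgebra θ)} (hc : (x : MaxCenter (SphereAlgebra θ)) = c) :
    ∃ ψ : CenterFiber c →⋆ₐ[ℂ] Matrix (Fin n) (Fin n) ℂ, ∀ k,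
      trivSection φ (genSection e k) x =
        ψ (Ideal.Quotient.mk (fiberIdeal c) (sphereGen θ k)) := by
  subst hc
  exact ⟨((φ ⟨x, hx⟩ : B.Fiber x ≃⋆ₐ[ℂ] Matrix (Fin n) (Fin n) ℂ) :
    B.Fiber x →⋆ₐ[ℂ] Matrix (Fin n) (Fin n) ℂ).comp (embeddingHom e x),
    fun _ => trivSection_of_mem _ hx⟩

variable (hF : IsSphereFamily θ (clockShiftGen (q := q) ω i)) (hω : IsPrimitiveRoot ω q)

/-- The point of the solid torus with parameter `y`. -/
def torusPoint (hij : j ≠ i) (y : ℝ × ℂ) : heegaardSolidTorus θ i :=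
  ⟨centralPoint hF hω y, centralPoint_mem hF hω hij y⟩

lemma continuous_torusPoint (hij : j ≠ i) : Continuous (torusPoint hF hω hij) :=
  (continuous_centralPoint hF hω).subtype_mk _

/-- The generators of the quantum sphere, normalised and written as matrices by means of the
embedding and a local trivialization of `B`. -/
def sphereChart (hij : j ≠ i) (hωe : ω = Complex.exp (2 * Real.pi * Complex.I * θ i j))
    (hθ : ∀ i j, Complex.exp (2 * Real.pi * Complex.I * θ i j) ^ q = 1)
    (e : StarAlgebraBundle.Embedding
      ((sphereBundle θ).restrict (heegaardSolidTorus θ i)) B)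
    {U : Set (heegaardSolidTorus θ i)} (hU : IsOpen U)
    {φ : ∀ y : U, B.Fiber y ≃⋆ₐ[ℂ] Matrix (Fin n) (Fin n) ℂ} (hφ : IsHomeomorph (trivMap φ)) :
    RotationChart q n ω (-(2 * Real.pi * θ i j)) where
  W := torusPoint hF hω hij ⁻¹' U
  X y := (longCoeff y)⁻¹ • trivSection φ (genSection e i) (torusPoint hF hω hij y)
  V y := (transScale y.2 : ℂ)⁻¹ • trivSection φ (genSection e j) (torusPoint hF hω hij y)
  isOpen := hU.preimage (continuous_torusPoint hF hω hij)
  continuousOn_X := by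
    refine ContinuousOn.smul (continuous_longCoeff.inv₀ longCoeff_ne_zero).continuousOn ?_
    exact (continuousOn_trivSection hφ (continuous_genSection e i)).comp
      (continuous_torusPoint hF hω hij).continuousOn fun y hy => hy
  continuousOn_V := by
    have h : Continuous fun y : ℝ × ℂ => (transScale y.2 : ℂ)⁻¹ :=
      (Complex.continuous_ofReal.comp (continuous_transScale.comp continuous_snd)).inv₀
        fun y => Complex.ofReal_ne_zero.2 (transScale_pos _).ne'
    refine h.continuousOn.smul ?_
    exact (continuousOn_trivSection hφ (continuous_genSection e j)).comp
      (continuous_torusPoint hF hω hij).continuousOn fun y hy => hy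
  comm y hy := by
    obtain ⟨ψ, hψ⟩ := exists_trivSection_genSection φ e hy (c := centralPoint hF hω y) rfl
    have h : sphereGen θ j * sphereGen θ i = ω • (sphereGen θ i * sphereGen θ j) := by
      rw [hωe]; exact isSphereFamily_sphereGen.comm i j
    have h1 := congrArg (Ideal.Quotient.mk (fiberIdeal (centralPoint hF hω y))) h
    have h2 : Ideal.Quotient.mk (fiberIdeal (centralPoint hF hω y))
        (ω • (sphereGen θ i * sphereGen θ j)) =
        ω • Ideal.Quotient.mk (fiberIdeal (centralPoint hF hω y)) (sphereGen θ i * sphereGen θ j) :=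
      rfl
    rw [h2, map_mul, map_mul] at h1
    have h3 := congrArg ψ h1
    rw [map_smul, map_mul, map_mul] at h3
    rw [hψ, hψ, smul_mul_smul_comm, smul_mul_smul_comm]
    refine (congrArg _ h3).trans ?_
    rw [smul_smul, smul_smul]
    congr 1; ring
  X_pow y hy := by
    obtain ⟨ψ, hψ⟩ := exists_trivSection_genSection φ e hy (c := centralPoint hF hω y) rfl
    have h := congrArg ψ (mk_sphereGen_self_pow hF hω hθ y)
    rw [map_pow, map_smul, map_one] at h
    rw [hψ, smul_pow]
    refine (congrArg _ h).trans ?_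
    rw [smul_smul, ← mul_pow, inv_mul_cancel₀ (longCoeff_ne_zero y), one_pow, one_smul]
  V_pow y hy := by
    obtain ⟨ψ, hψ⟩ := exists_trivSection_genSection φ e hy (c := centralPoint hF hω y) rfl
    have h := congrArg ψ (mk_sphereGen_ne_pow hF hω hij hθ y)
    rw [map_pow, map_smul, map_one] at h
    rw [hψ, smul_pow]
    refine (congrArg _ h).trans ?_
    rw [smul_smul, ← mul_pow, transCoeff,
      inv_mul_cancel_left₀ (Complex.ofReal_ne_zero.2 (transScale_pos _).ne')]
  star_V_mul_V y hy := by
    obtain ⟨ψ, hψ⟩ := exists_trivSection_genSection φ e hy (c := centralPoint hF hω y) rfl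
    have h := congrArg ψ (star_mk_mul_mk_sphereGen_ne hF hω hij y)
    rw [map_mul, map_star, map_smul, map_one] at h
    rw [hψ, star_smul, smul_mul_smul_comm]
    refine (congrArg _ h).trans ?_
    have h0 : (transScale y.2 : ℂ) ≠ 0 := Complex.ofReal_ne_zero.2 (transScale_pos _).ne'
    rw [smul_smul, norm_transCoeff]
    congr 1
    rw [star_inv₀, Complex.star_def, Complex.conj_ofReal]
    push_cast
    field_simp
  shift_mem s b hy := by
    rw [Set.mem_preimage] at hy ⊢
    have h : torusPoint hF hω hij (s + -(2 * Real.pi * θ i j), b) = torusPoint hF hω hij (s, b) :=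
      Subtype.ext (centralPoint_shift hF hω hij (exp_shift_mul hωe) s b)
    rwa [h]
  shift_X s b hy := by
    have h : torusPoint hF hω hij (s + -(2 * Real.pi * θ i j), b) = torusPoint hF hω hij (s, b) :=
      Subtype.ext (centralPoint_shift hF hω hij (exp_shift_mul hωe) s b)
    have hω0 := hω.ne_zero (NeZero.ne q)
    have e1 : longCoeff (s + -(2 * Real.pi * θ i j), b) = longCoeff (s, b) * ω⁻¹ := by
      rw [eq_mul_inv_iff_mul_eq₀ hω0]
      exact longCoeff_shift (exp_shift_mul hωe) s b
    rw [h, e1, mul_inv, inv_inv, mul_comm, mul_smul]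
  shift_V s b hy := by
    have h : torusPoint hF hω hij (s + -(2 * Real.pi * θ i j), b) = torusPoint hF hω hij (s, b) :=
      Subtype.ext (centralPoint_shift hF hω hij (exp_shift_mul hωe) s b)
    rw [h]
  rotate_X s b hy := by
    have hζ := (Complex.isPrimitiveRoot_exp q (NeZero.ne q)).pow_eq_one
    have h : torusPoint hF hω hij (s, Complex.exp (2 * Real.pi * Complex.I / q) * b) =
      torusPoint hF hω hij (s, b) := Subtype.ext (centralPoint_rotate hF hω hij hζ s b)
    rw [h]
    simp only [longCoeff, longRadius, norm_mul, Complex.norm_eq_one_of_pow_eq_one hζ (NeZero.ne q),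
      one_mul]
  rotate_V s b hy := by
    have hζ := (Complex.isPrimitiveRoot_exp q (NeZero.ne q)).pow_eq_one
    have h : torusPoint hF hω hij (s, Complex.exp (2 * Real.pi * Complex.I / q) * b) =
      torusPoint hF hω hij (s, b) := Subtype.ext (centralPoint_rotate hF hω hij hζ s b)
    rw [h]
    simp only [transScale, norm_mul, Complex.norm_eq_one_of_pow_eq_one hζ (NeZero.ne q), one_mul]

end SphereCharts

lemma isPrimitiveRoot_exp_of_isCoprime {p : ℤ} {q : ℕ} (hq : 0 < q) (h : IsCoprime p (q : ℤ)) :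
    IsPrimitiveRoot (Complex.exp (2 * Real.pi * Complex.I * ((p / q : ℝ) : ℂ))) q := by
  have h1 := (Complex.isPrimitiveRoot_exp q hq.ne').zpow_of_gcd_eq_one p
    (Int.isCoprime_iff_gcd_eq_one.1 h)
  rw [← Complex.exp_int_mul] at h1
  have e : (2 * Real.pi * Complex.I * ((p / q : ℝ) : ℂ) : ℂ) =
      p * (2 * Real.pi * Complex.I / q) := by push_cast; ring
  rwa [e]

end

theorem mainTheorem6 (p : ℤ) (q : ℕ) (hq : 0 < q) (hpq : IsCoprime p (q : ℤ))
    (θ : Matrix (Fin 2) (Fin 2) ℝ) (hskew : θ.transpose = -θ) (hθ : θ 0 1 = (p : ℝ) / (q : ℝ))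
    (i : Fin 2) (n : ℕ)
    (B : StarAlgebraBundle.{1, v} (heegaardSolidTorus θ i))
    (hB : B.IsLocallyTrivialMatrixBundle n)
    (hemb : Nonempty (StarAlgebraBundle.Embedding
      ((sphereBundle θ).restrict (heegaardSolidTorus θ i)) B)) :
    q ^ 2 ∣ n := by
  have : NeZero q := ⟨hq.ne'⟩
  obtain ⟨e⟩ := hemb
  have hsk : ∀ k l, θ l k = -θ k l := fun k l => congrFun (congrFun hskew k) l
  have hne : ∀ k l : Fin 2, k ≠ l → ∃ p' : ℤ, IsCoprime p' (q : ℤ) ∧ θ k l = (p' : ℝ) / q := by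
    intro k l hkl
    have h10 : θ 1 0 = ((-p : ℤ) : ℝ) / q := by rw [hsk 0 1, hθ]; push_cast; ring
    fin_cases k <;> fin_cases l
    · exact absurd rfl hkl
    · exact ⟨p, hpq, hθ⟩
    · exact ⟨-p, hpq.neg_left, h10⟩
    · exact absurd rfl hkl
  have hprim : ∀ k l : Fin 2, k ≠ l →
      IsPrimitiveRoot (Complex.exp (2 * Real.pi * Complex.I * θ k l)) q := by
    intro k l hkl
    obtain ⟨p', hp', h⟩ := hne k l hkl
    rw [h]
    exact isPrimitiveRoot_exp_of_isCoprime hq hp'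
  have hroot : ∀ k l, Complex.exp (2 * Real.pi * Complex.I * θ k l) ^ q = 1 := by
    intro k l
    rcases eq_or_ne k l with rfl | hkl
    · have h0 : θ k k = 0 := by have := hsk k k; linarith
      simp [h0]
    · exact (hprim k l hkl).pow_eq_one
  obtain ⟨j, hij⟩ := exists_ne i
  obtain ⟨ω, hωe⟩ : ∃ ω, ω = Complex.exp (2 * Real.pi * Complex.I * θ i j) := ⟨_, rfl⟩
  have hω : IsPrimitiveRoot ω q := hωe ▸ hprim i j hij.symm
  have hF := isSphereFamily_clockShiftGen (q := q) hskew hij hωe hω.pow_eq_one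
  choose U hU hxU φ hφ using hB
  refine sq_dvd_of_rotationChart_cover hq hω
    (fun x => sphereChart hF hω hij hωe hroot e (hU x) (φ := φ x) (hφ x))
    (fun s => ⟨torusPoint hF hω hij (s, 0), hxU _⟩) fun x x' => ?_
  refine ⟨fun y => trivChange (φ x) (φ x') (torusPoint hF hω hij y), fun y hy => ⟨?_, ?_⟩,
    fun G => ?_⟩
  · simp only [sphereChart, map_smul]
    exact congrArg _ (trivChange_trivSection _ hy)
  · simp only [sphereChart, map_smul]
    exact congrArg _ (trivChange_trivSection _ hy)
  · exact (continuousOn_trivChange (hφ x) (hφ x') G).comp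
      (continuous_torusPoint hF hω hij).continuousOn fun y hy => hy
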